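/- **Setting.** Consider a simple step-stress accelerated life test with stress levels $x_1<x_2$ and inspection times $0=t_0<t_1<\dots<t_L$, where the stress is raised from $x_1$ to $x_2$ at $\tau=t_k$ for some $1\le k<L$. The baseline hazard is $h_0(t)=\sum_{i=0}^m\gamma_it^i$ with $m=1$ (linear) or $m=2$ (quadratic), $H_0(t)=\int_0^th_0=\sum_{i=0}^m\gamma_it^{i+1}/(i+1)$, and the parameter is $\theta=(\gamma_0,\dots,\gamma_m,a_1)\in\Theta=(0,\infty)^{m+2}$. Under proportional hazards and cumulative exposure, a lifetime has reliability $R_\theta(t)=e^{-H_\theta(t)}$ with $H_\theta(t)=e^{a_1x_1}H_0(t)$ for $t<\tau$ and $H_\theta(t)=e^{a_1x_2}H_0(t+s)$ for $t\ge\tau$, where $s=s(\theta)$ is the greatest negative solution of $H_0(\tau+s)=e^{a_1(x_1-x_2)}H_0(\tau)$. The same formulas are used on $[0,\infty)^{m+2}$ (with $s=0$ if $a_1=0$). The cell probabilities are $\pi_j(\theta)=R_\theta(t_{j-1})-R_\theta(t_j)$ for $1\le j\le L$ and $\pi_{L+1}(\theta)=R_\theta(t_L)$. For a count vector $n=(n_1,\dots,n_{L+1})$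 with $N=\sum_jn_j$ put $\hat p=n/N$. For $\beta\ge0$ an MDPDE is a minimizer over $\theta\in\Theta$ of $d_\beta(\hat p,\pi(\theta))$, where $$d_\beta(p,q)=\sum_j\Big(q_j^{\beta+1}-\big(1+\tfrac1\beta\big)q_j^\beta p_j+\tfrac1\beta p_j^{\beta+1}\Big)\ (\beta>0),\qquad d_0(p,q)=\sum_jp_j\log\frac{p_j}{q_j}.$$ Let $W(\theta)=(\partial\pi_j/\partial\theta_i)_{j,i}$ be the $(L+1)\times(m+2)$ Jacobian matrix of $\pi$, $D(\theta)=\operatorname{diag}(\pi(\theta))$, $\pi^\beta=(\pi_j^\beta)_j$, and $$J_\beta=W^TD^{\beta-1}W,\qquad K_\beta=W^T\big(D^{2\beta-1}-\pi^\beta(\pi^\beta)^T\big)W,\qquad \Sigma_\beta=J_\beta^{-1}K_\beta J_\beta^{-1}.$$ **Theorem.** Let $\beta\ge0$, let $\theta^*\in\Theta$ be the true parameter, and for each $N$ let the counts be multinomial with $N$ trials and cell probabilities $\pi(\theta^*)$. Let $\hat\theta^\beta=\hat\theta^\beta_N$ be a random vector that is almost surely an MDPDE for these counts whenever one exists (and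 is arbitrary otherwise). Assume that $k\ge m+1$ or $L-k\ge m+1$; or else that $J_\beta(\theta^*)$ is nonsingular and $\theta^*$ is identifiable, i.e. $\pi(\theta)=\pi(\theta^*)$ with $\theta\in[0,\infty)^{m+2}$ implies $\theta=\theta^*$. Then $\pi$ is differentiable at $\theta^*$, $J_\beta(\theta^*)$ is nonsingular, $\Sigma_\beta(\theta^*)$ is positive semidefinite, and $$\sqrt N\,(\hat\theta^\beta-\theta^*)\xrightarrow[N\to\infty]{\mathcal L}\mathcal N\big(0,\Sigma_\beta(\theta^*)\big).$$ For $\beta=0$ the MDPDE is the MLE: for all counts, $\theta$ minimizes $d_0(\hat p,\pi(\cdot))$ over $\Theta$ if and only if it maximizes $\sum_jn_j\log\pi_j(\cdot)$ over $\Theta$. Moreover the Fisher information matrix of one device, $I_F(\theta^*)=\sum_j\pi_j\,(\nabla\log\pi_j)(\nabla\log\pi_j)^T$ at $\theta^*$, equals $W^TD^{-1}W$ at $\theta^*$, and $\Sigma_0(\theta^*)=I_F(\theta^*)^{-1}$. -/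

import Mathlib

open MeasureTheory ProbabilityTheory Filter Topology

noncomputable section

namespace StepStress

/-- A simple step-stress accelerated life test with interval monitoring: stress levels `x₁ < x₂`,
inspection times `0 = t₀ < t₁ < ⋯ < t_L`, and stress change at the inspection time `τ = t_k`
with `1 ≤ k < L`. -/
structure Design (L : ℕ) where
  x₁ : ℝ
  x₂ : ℝ
  stress_lt : x₁ < x₂
  t : Fin (L + 1) → ℝ
  t_zero : t 0 = 0
  t_strictMono : StrictMono t
  k : Fin (L + 1)
  k_pos : 0 < k
  k_lt : k < Fin.last L

/-- The model parameter `θ = (γ₀, …, γ_m, a₁)` for a polynomial baseline hazard of degree `m`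
(`m = 1`: linear, `m = 2`: quadratic). -/
abbrev Param (m : ℕ) : Type := EuclideanSpace ℝ (Fin (m + 2))

/-- The baseline hazard coefficient `γᵢ`. -/
def gam {m : ℕ} (θ : Param m) (i : Fin (m + 1)) : ℝ := θ i.castSucc

/-- The regression coefficient `a₁` of the stress. -/
def slope {m : ℕ} (θ : Param m) : ℝ := θ (Fin.last (m + 1))

/-- The parameter space: all coordinates positive. -/
def paramSpace (m : ℕ) : Set (Param m) := {θ | ∀ i, 0 < θ i}

/-- The cumulative baseline hazard `∫₀ᵗ h₀ = γ₀ t + γ₁ t² / 2 + ⋯ + γ_m t^(m+1) / (m+1)` of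
`h₀(t) = γ₀ + γ₁ t + ⋯ + γ_m t^m`. -/
def baseCumHazard {m : ℕ} (θ : Param m) (t : ℝ) : ℝ :=
  ∑ i : Fin (m + 1), gam θ i * t ^ ((i : ℕ) + 1) / ((i : ℕ) + 1)

variable {L m : ℕ} (S : Design L)

/-- The time of stress change. -/
def Design.τ : ℝ := S.t S.k

/-- The shifting time of the cumulative exposure model: the greatest negative solution `s` of
`H₀(τ + s) = exp(a₁ (x₁ - x₂)) H₀(τ)`. On the parameter space `s = 0` is not a solution; it is
admitted so that the definition also makes sense on the boundary `a₁ = 0`, where `s = 0`. -/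
def Design.shift (θ : Param m) : ℝ :=
  sSup {s : ℝ | s ≤ 0 ∧ baseCumHazard θ (S.τ + s)
    = Real.exp (slope θ * (S.x₁ - S.x₂)) * baseCumHazard θ S.τ}

/-- The cumulative hazard of a lifetime in the step-stress experiment. -/
def Design.cumHazard (θ : Param m) (t : ℝ) : ℝ :=
  if t < S.τ then Real.exp (slope θ * S.x₁) * baseCumHazard θ t
  else Real.exp (slope θ * S.x₂) * baseCumHazard θ (t + S.shift θ)

/-- The reliability function. -/
def Design.reliability (θ : Param m) (t : ℝ) : ℝ := Real.exp (-S.cumHazard θ t)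

/-- The cell probabilities `π(θ)`: failure in the `L` inspection intervals, and survival at the
termination time `t_L` in the last cell. -/
def Design.cellProb (θ : Param m) : Fin (L + 1) → ℝ :=
  Fin.snoc (α := fun _ => ℝ)
    (fun j : Fin L => S.reliability θ (S.t j.castSucc) - S.reliability θ (S.t j.succ))
    (S.reliability θ (S.t (Fin.last L)))

/-- The density power divergence between probability vectors; at `β = 0` the Kullback-Leibler
divergence. -/
def dpd {ι : Type*} [Fintype ι] (β : ℝ) (p q : ι → ℝ) : ℝ :=
  if β = 0 then ∑ j, p j * Real.log (p j / q j)
  else ∑ j, (q j ^ (β + 1) - (1 + 1 / β) * (q j ^ β * p j) + 1 / β * p j ^ (β + 1))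

/-- The empirical probability vector `(n₁ / N, …, n_{L+1} / N)`, `N = ∑ nⱼ`. -/
def empirical {ι : Type*} [Fintype ι] (n : ι → ℕ) : ι → ℝ := fun j => (n j : ℝ) / ∑ i, (n i : ℝ)

/-- `θ` is a minimum density power divergence estimate for the data `n`. -/
def Design.IsMDPDE (β : ℝ) (n : Fin (L + 1) → ℕ) (θ : Param m) : Prop :=
  θ ∈ paramSpace m ∧
    IsMinOn (fun θ' : Param m => dpd β (empirical n) (S.cellProb θ')) (paramSpace m) θ

/-- `θ` is a maximum likelihood estimate for the data `n` (multinomial log-likelihood). -/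
def Design.IsMLE (n : Fin (L + 1) → ℕ) (θ : Param m) : Prop :=
  θ ∈ paramSpace m ∧
    IsMaxOn (fun θ' : Param m => ∑ j, (n j : ℝ) * Real.log (S.cellProb θ' j)) (paramSpace m) θ

/-- The random vector `n` has the multinomial distribution with `N` trials and cell
probabilities `p`. -/
def IsMultinomial {Ω ι : Type*} [Fintype ι] [MeasurableSpace Ω] (P : Measure Ω) (N : ℕ) (p : ι → ℝ)
    (n : Ω → ι → ℕ) : Prop :=
  AEMeasurable n P ∧ ∀ v : ι → ℕ, ∑ j, v j = N →
    P {ω | n ω = v} = ENNReal.ofReal (Nat.multinomial Finset.univ v * ∏ j, p j ^ v j)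

/-- The partial derivative `∂f/∂θᵢ`. -/
def partialDeriv (f : Param m → ℝ) (θ : Param m) (i : Fin (m + 2)) : ℝ :=
  fderiv ℝ f θ (EuclideanSpace.single i 1)

/-- The Jacobian matrix of the cell probabilities, `W(θ)ⱼᵢ = ∂πⱼ(θ)/∂θᵢ`. -/
def Design.W (θ : Param m) : Matrix (Fin (L + 1)) (Fin (m + 2)) ℝ :=
  Matrix.of fun j i => partialDeriv (fun θ' => S.cellProb θ' j) θ i

/-- The power `D(θ)^r` of the diagonal matrix with diagonal entries `πⱼ(θ)`. -/
def Design.Dpow (θ : Param m) (r : ℝ) : Matrix (Fin (L + 1)) (Fin (L + 1)) ℝ :=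
  Matrix.diagonal fun j => S.cellProb θ j ^ r

/-- `J_β = Wᵀ D^(β-1) W`. -/
def Design.J (β : ℝ) (θ : Param m) : Matrix (Fin (m + 2)) (Fin (m + 2)) ℝ :=
  (S.W θ).transpose * S.Dpow θ (β - 1) * S.W θ

/-- `K_β = Wᵀ (D^(2β-1) - π^β (π^β)ᵀ) W`. -/
def Design.K (β : ℝ) (θ : Param m) : Matrix (Fin (m + 2)) (Fin (m + 2)) ℝ :=
  (S.W θ).transpose *
    (S.Dpow θ (2 * β - 1) -
      Matrix.vecMulVec (fun j => S.cellProb θ j ^ β) (fun j => S.cellProb θ j ^ β)) *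
    S.W θ

/-- `Σ_β = J_β⁻¹ K_β J_β⁻¹`. -/
def Design.asympCov (β : ℝ) (θ : Param m) : Matrix (Fin (m + 2)) (Fin (m + 2)) ℝ :=
  (S.J β θ)⁻¹ * S.K β θ * (S.J β θ)⁻¹

/-- The Fisher information matrix of the model for one device: the expected outer product of the
gradient of the log-likelihood. -/
def Design.fisherInfo (θ : Param m) : Matrix (Fin (m + 2)) (Fin (m + 2)) ℝ :=
  Matrix.of fun a b => ∑ j, S.cellProb θ j *
    (partialDeriv (fun θ' => Real.log (S.cellProb θ' j)) θ a *
      partialDeriv (fun θ' => Real.log (S.cellProb θ' j)) θ b)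

/-- `θ₀` is identified by its cell probabilities within the closed parameter space. -/
def Design.IdentifiableAt (θ₀ : Param m) : Prop :=
  ∀ θ : Param m, (∀ i, 0 ≤ θ i) → S.cellProb θ = S.cellProb θ₀ → θ = θ₀

end StepStress

end

noncomputable section

namespace StepStress

/-! ### Multinomial vectors: characteristic function and central limit theorem -/

/-! The estimator is treated as a function of the empirical vector p alone. With r = π(θ*), the
divergence d_β(p, q) near p = q = r agrees, up to a relative error tending to zero, with the
weighted square (β+1)/2 · ∑ r_j^(β-1) (q_j - p_j)². Hence every minimizer is to first order the
weighted least squares solution θ* + A(p - r), with A = J_β⁻¹ Wᵀ D^(β-1) (`isLittleO_argmin_sub`,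
`eventually_norm_argmin_sub_le`). This uses only differentiability of π at θ*: there are no
estimating equations, and minimizers need not be unique. The multinomial central limit theorem,
pushed through A, gives the covariance A (D - π πᵀ) Aᵀ, which is Σ_β (`asympCov_eq`).

The expansion is local, so minimizers must be shown to be near θ*. A small divergence forces π(θ) to
be near r (`eventually_close_of_dpd_le`). That θ is then near θ* is a compactness argument on the
noncompact set Θ: the hazards at τ and t_L bound all coordinates, and any limit point lies in the
closed orthant with the same cell probabilities. This is why identifiability is required there. The
same estimate shows that minimizers exist with probability tending to one.

Identifiability and full rank of W rest on polynomials. The cell probabilities determine the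
cumulative hazard at the inspection times, and in each phase it is a polynomial of degree at most m
+ 1, so m + 2 nodes fix it. If the first phase is fixed, the slope follows from strict log-concavity
of H₀ for m ≤ 2; if the second is fixed, its zero gives the time shift and the hazard at τ gives the
slope. Linearizing gives the rank statement. -/

lemma mem_piAntidiag_univ {ι : Type*} [Fintype ι] [DecidableEq ι] {N : ℕ} {v : ι → ℕ} :
    v ∈ (Finset.univ : Finset ι).piAntidiag N ↔ ∑ j, v j = N := by
  simp [Finset.mem_piAntidiag]

lemma IsMultinomial.map_singleton {Ω ι : Type*} [Fintype ι] [MeasurableSpace Ω] {P : Measure Ω}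
    {N : ℕ} {p : ι → ℝ} {n : Ω → ι → ℕ}
    (h : IsMultinomial P N p n) {v : ι → ℕ} (hv : ∑ j, v j = N) :
    (P.map n) {v} = ENNReal.ofReal (Nat.multinomial Finset.univ v * ∏ j, p j ^ v j) := by
  rw [Measure.map_apply_of_aemeasurable h.1 (measurableSet_singleton v), ← h.2 v hv]
  rfl

section Multinomial

variable {Ω ι : Type*} [Fintype ι] [MeasurableSpace Ω] {P : Measure Ω}
  [IsProbabilityMeasure P] {N : ℕ} {p : ι → ℝ} {n : Ω → ι → ℕ}

/-- By the multinomial theorem the prescribed masses add up to (∑ p_j)^N = 1, so nothing is left for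
count vectors with another total, about which `IsMultinomial` says nothing. -/
lemma IsMultinomial.ae_map_mem [DecidableEq ι] (h : IsMultinomial P N p n) (hp : ∀ j, 0 ≤ p j)
    (hs : ∑ j, p j = 1) :
    ∀ᵐ v ∂(P.map n), v ∈ ((Finset.univ : Finset ι).piAntidiag N : Set (ι → ℕ)) := by
  have : IsProbabilityMeasure (P.map n) := Measure.isProbabilityMeasure_map h.1
  refine (mem_ae_iff_prob_eq_one (Finset.measurableSet _)).2 ?_
  rw [← sum_measure_singleton]
  have h1 : ∀ v ∈ (Finset.univ : Finset ι).piAntidiag N, (P.map n) {v} =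
      ENNReal.ofReal (Nat.multinomial Finset.univ v * ∏ j, p j ^ v j) :=
    fun v hv => h.map_singleton (mem_piAntidiag_univ.1 hv)
  rw [Finset.sum_congr rfl h1, ← ENNReal.ofReal_sum_of_nonneg, ← Finset.sum_pow_eq_sum_piAntidiag,
    hs, one_pow, ENNReal.ofReal_one]
  intro v _
  have : 0 ≤ ∏ j, p j ^ v j := Finset.prod_nonneg fun j _ => pow_nonneg (hp j) _
  positivity

/-- The cell counts add up to the number of trials. -/
lemma IsMultinomial.ae_sum_eq (h : IsMultinomial P N p n) (hp : ∀ j, 0 ≤ p j)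
    (hs : ∑ j, p j = 1) : ∀ᵐ ω ∂P, ∑ j, n ω j = N := by
  classical
  filter_upwards [ae_of_ae_map h.1 (h.ae_map_mem hp hs)] with ω hω
  exact mem_piAntidiag_univ.1 hω

/-- The characteristic function of a multinomial vector. -/
lemma IsMultinomial.integral_cexp (h : IsMultinomial P N p n) (hp : ∀ j, 0 ≤ p j)
    (hs : ∑ j, p j = 1) (t : ι → ℝ) :
    ∫ ω, Complex.exp ((∑ j, t j * n ω j : ℝ) * Complex.I) ∂P
      = (∑ j, p j * Complex.exp (t j * Complex.I)) ^ N := by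
  classical
  have hprob : IsProbabilityMeasure (P.map n) := Measure.isProbabilityMeasure_map h.1
  have hmeas : Measurable fun v : ι → ℕ => Complex.exp ((∑ j, t j * v j : ℝ) * Complex.I) :=
    Measurable.of_discrete
  rw [← integral_map (φ := n)
    (f := fun v : ι → ℕ => Complex.exp ((∑ j, t j * v j : ℝ) * Complex.I)) h.1
    hmeas.aestronglyMeasurable, ← setIntegral_eq_integral_of_ae_compl_eq_zero
      (s := ((Finset.univ : Finset ι).piAntidiag N : Set (ι → ℕ))), setIntegral_finset]
  -- The multinomial theorem again, now with the weights p_j exp(i t_j).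
  · rw [Finset.sum_pow_eq_sum_piAntidiag]
    refine Finset.sum_congr rfl fun v hv => ?_
    have h0 : 0 ≤ ∏ j, p j ^ v j := Finset.prod_nonneg fun j _ => pow_nonneg (hp j) _
    rw [Measure.real, h.map_singleton (mem_piAntidiag_univ.1 hv),
      ENNReal.toReal_ofReal (by positivity), Complex.real_smul]
    simp only [mul_pow, Finset.prod_mul_distrib, ← Complex.exp_nat_mul, ← Complex.exp_sum]
    push_cast
    rw [Finset.sum_mul, mul_assoc]
    congr 4 with j
    ring
  · exact (Integrable.of_bound hmeas.aestronglyMeasurable 1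
      (ae_of_all _ fun v => by rw [Complex.norm_exp_ofReal_mul_I])).integrableOn
  · filter_upwards [h.ae_map_mem hp hs] with v hv hv'
    exact absurd hv hv'

end Multinomial

/-- Taylor expansion at z = ix/√N: N z² is exactly -x², and the cubic remainder is N · O(N^(-3/2)).
-/
lemma tendsto_natCast_mul_cexp_sub (x : ℝ) :
    Tendsto (fun N : ℕ => (N : ℂ) * (Complex.exp ((x / √N : ℝ) * Complex.I) - 1
      - (x / √N : ℝ) * Complex.I)) atTop (𝓝 (-(x : ℂ) ^ 2 / 2)) := by
  have hsq : Tendsto (fun N : ℕ => √(N : ℝ)) atTop atTop :=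
    Real.tendsto_sqrt_atTop.comp tendsto_natCast_atTop_atTop
  have hz : Tendsto (fun N : ℕ => |x| / √(N : ℝ)) atTop (𝓝 0) :=
    tendsto_const_nhds.div_atTop hsq
  rw [tendsto_iff_norm_sub_tendsto_zero]
  -- The constant is 4 / (3! · 3), the remainder constant of `Complex.exp_bound` for n = 3.
  have hb : Tendsto (fun N : ℕ => |x| ^ 3 * (4 * (6 * 3)⁻¹) / √(N : ℝ)) atTop (𝓝 0) :=
    tendsto_const_nhds.div_atTop hsq
  refine squeeze_zero' (Eventually.of_forall fun _ => norm_nonneg _) ?_ hb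
  filter_upwards [hz.eventually (ge_mem_nhds zero_lt_one), eventually_gt_atTop 0] with N hN hN0
  have hNpos : (0 : ℝ) < N := by exact_mod_cast hN0
  have hs : 0 < √(N : ℝ) := Real.sqrt_pos.2 hNpos
  have hss : √(N : ℝ) ^ 2 = N := Real.sq_sqrt hNpos.le
  set z : ℂ := (x / √N : ℝ) * Complex.I with hzdef
  have hnz : ‖z‖ = |x| / √(N : ℝ) := by
    rw [hzdef, norm_mul, Complex.norm_I, mul_one, Complex.norm_real, Real.norm_eq_abs, abs_div,
      abs_of_pos hs]
  have key := Complex.exp_bound (x := z) (by rw [hnz]; exact hN) (n := 3) (by norm_num)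
  simp only [Finset.sum_range_succ, Finset.sum_range_zero] at key
  have hz2 : (N : ℂ) * z ^ 2 = -(x : ℂ) ^ 2 := by
    rw [hzdef, mul_pow, Complex.I_sq]
    have : (N : ℝ) * (x / √N) ^ 2 = x ^ 2 := by
      rw [div_pow, hss]; field_simp
    have h' : (N : ℂ) * ((x / √N : ℝ) : ℂ) ^ 2 = (x : ℂ) ^ 2 := by exact_mod_cast this
    linear_combination (-1 : ℂ) * h'
  have heq : (N : ℂ) * (Complex.exp z - 1 - z) - -(x : ℂ) ^ 2 / 2
      = (N : ℂ) * (Complex.exp z - (0 + z ^ 0 / (Nat.factorial 0 : ℂ)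
        + z ^ 1 / (Nat.factorial 1 : ℂ) + z ^ 2 / (Nat.factorial 2 : ℂ))) := by
    rw [← hz2]
    simp [Nat.factorial]
    ring
  rw [heq, norm_mul]
  calc ‖(N : ℂ)‖ * _
      ≤ (N : ℝ) * (‖z‖ ^ 3 * ((Nat.succ 3 : ℕ) * ((Nat.factorial 3 : ℝ) * (3 : ℕ))⁻¹)) := by
        rw [Complex.norm_natCast]
        exact mul_le_mul_of_nonneg_left key hNpos.le
    _ = |x| ^ 3 * (4 * (6 * 3)⁻¹) / √(N : ℝ) := by
        rw [hnz]
        have : (N : ℝ) = √(N : ℝ) ^ 2 := hss.symm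
        simp only [Nat.factorial]
        push_cast
        field_simp
        rw [hss]
        ring

/-- The central limit theorem for a centred variable with finitely many values: centring removes the
first-order terms, and (1 + a_N / N)^N tends to exp a. -/
lemma tendsto_sum_cexp_pow {ι : Type*} [Fintype ι] {p x : ι → ℝ} (hs : ∑ j, p j = 1)
    (hx : ∑ j, p j * x j = 0) :
    Tendsto (fun N : ℕ => (∑ j, (p j : ℂ) * Complex.exp ((x j / √N : ℝ) * Complex.I)) ^ N) atTop
      (𝓝 (Complex.exp (-(∑ j, p j * x j ^ 2 : ℝ) / 2))) := by
  have h1 : Tendsto (fun N : ℕ => (N : ℂ) *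
      (∑ j, (p j : ℂ) * Complex.exp ((x j / √N : ℝ) * Complex.I) - 1)) atTop
      (𝓝 (-(∑ j, p j * x j ^ 2 : ℝ) / 2)) := by
    have h2 : Tendsto (fun N : ℕ => ∑ j, (p j : ℂ) * ((N : ℂ) *
        (Complex.exp ((x j / √N : ℝ) * Complex.I) - 1 - (x j / √N : ℝ) * Complex.I))) atTop
        (𝓝 (∑ j, (p j : ℂ) * (-(x j : ℂ) ^ 2 / 2))) :=
      tendsto_finsetSum _ fun j _ => (tendsto_natCast_mul_cexp_sub (x j)).const_mul _
    have hlim : ∑ j, (p j : ℂ) * (-(x j : ℂ) ^ 2 / 2) = (-(∑ j, p j * x j ^ 2 : ℝ) / 2 : ℂ) := by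
      push_cast
      rw [← Finset.sum_neg_distrib, Finset.sum_div]
      exact Finset.sum_congr rfl fun j _ => by ring
    rw [hlim] at h2
    refine h2.congr fun N => ?_
    have e1 : ∑ j, (p j : ℂ) = 1 := by exact_mod_cast hs
    have e2 : ∑ j, (p j : ℂ) * (x j : ℂ) = 0 := by exact_mod_cast hx
    have e3 : ∑ j, (p j : ℂ) * ((N : ℂ) * ((x j / √N : ℝ) * Complex.I)) = 0 := by
      calc _ = (∑ j, (p j : ℂ) * (x j : ℂ)) * ((N : ℂ) * ((1 / √N : ℝ) : ℂ) * Complex.I) := by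
            rw [Finset.sum_mul]
            refine Finset.sum_congr rfl fun j _ => ?_
            push_cast
            ring
        _ = 0 := by rw [e2, zero_mul]
    rw [mul_sub, Finset.mul_sum, ← e1, Finset.mul_sum]
    simp only [mul_sub, Finset.sum_sub_distrib]
    rw [e3, sub_zero]
    congr 1
    · exact Finset.sum_congr rfl fun j _ => by ring
    · exact Finset.sum_congr rfl fun j _ => by rw [e1, mul_one, mul_comm]
  have := Complex.tendsto_one_add_pow_exp_of_tendsto h1
  simpa using this

/-- The estimation error of the empirical probability vector. -/
def empiricalError {ι : Type*} [Fintype ι] (p : ι → ℝ) (v : ι → ℕ) : EuclideanSpace ℝ ι :=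
  WithLp.toLp 2 (fun j => empirical v j - p j)

lemma IsMultinomial.aemeasurable_smul_empiricalError {Ω ι : Type*} [Fintype ι] [MeasurableSpace Ω]
    {P : Measure Ω} {N : ℕ} {p : ι → ℝ} {n : Ω → ι → ℕ} (h : IsMultinomial P N p n) (c : ℝ) :
    AEMeasurable (fun ω => c • empiricalError p (n ω)) P :=
  (Measurable.of_discrete (f := fun v => c • empiricalError p v)).comp_aemeasurable h.1

lemma charFun_map_eq_integral {Ω E : Type*} [MeasurableSpace Ω] {P : Measure Ω}
    [NormedAddCommGroup E] [InnerProductSpace ℝ E] [MeasurableSpace E] [BorelSpace E]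
    [SecondCountableTopology E] {X : Ω → E} (hX : AEMeasurable X P) (t : E) :
    charFun (P.map X) t = ∫ ω, Complex.exp ((inner ℝ (X ω) t : ℝ) * Complex.I) ∂P := by
  rw [charFun_apply, integral_map hX]
  exact Measurable.aestronglyMeasurable (by fun_prop)

/-- The characteristic function of the normalized error of the empirical probability vector. -/
lemma IsMultinomial.charFun_sqrt_smul_empiricalError {Ω ι : Type*} [Fintype ι] [MeasurableSpace Ω]
    {P : Measure Ω} [IsProbabilityMeasure P] {N : ℕ} {p : ι → ℝ} {n : Ω → ι → ℕ}
    (h : IsMultinomial P N p n) (hp : ∀ j, 0 ≤ p j) (hs : ∑ j, p j = 1) (hN : 0 < N)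
    (t : EuclideanSpace ℝ ι) :
    charFun (P.map fun ω => √(N : ℝ) • empiricalError p (n ω)) t =
      (∑ j, (p j : ℂ) * Complex.exp (((t j - ∑ i, p i * t i) / √N : ℝ) * Complex.I)) ^ N := by
  rw [charFun_map_eq_integral (h.aemeasurable_smul_empiricalError _), ← h.integral_cexp hp hs]
  refine integral_congr_ae ?_
  filter_upwards [h.ae_sum_eq hp hs] with ω hω
  have hω' : ∑ i, (n ω i : ℝ) = N := by exact_mod_cast hω
  have hNpos : (0 : ℝ) < N := by exact_mod_cast hN
  have hsq : √(N : ℝ) ≠ 0 := (Real.sqrt_pos.2 hNpos).ne'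
  -- With s = ⟨t, n⟩ - N ⟨t, p⟩, one exponent is √N · s / N and the other s / √N.
  congr 3
  rw [real_inner_smul_left, PiLp.inner_apply]
  simp only [empiricalError, empirical, hω', RCLike.inner_apply, conj_trivial]
  have e1 : ∑ x, (t.ofLp x - ∑ i, p i * t.ofLp i) / √↑N * ↑(n ω x)
      = (∑ x, t x * n ω x - (∑ i, p i * t i) * N) / √N := by
    rw [← hω', Finset.mul_sum, ← Finset.sum_sub_distrib, Finset.sum_div]
    exact Finset.sum_congr rfl fun j _ => by ring
  have e2 : ∑ x, t.ofLp x * (↑(n ω x) / ↑N - p x)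
      = (∑ x, t x * n ω x - (∑ i, p i * t i) * N) / N := by
    rw [sub_div, mul_div_assoc, div_self hNpos.ne', mul_one, Finset.sum_div,
      ← Finset.sum_sub_distrib]
    exact Finset.sum_congr rfl fun j _ => by ring
  rw [e1, e2, mul_div_assoc']
  rw [div_eq_div_iff hNpos.ne' hsq]
  have := Real.mul_self_sqrt hNpos.le
  linear_combination (∑ x, t x * n ω x - (∑ i, p i * t i) * N) * this

section Sequences

variable {Ω : ℕ → Type*} [∀ N, MeasurableSpace (Ω N)] {P : (N : ℕ) → Measure (Ω N)}
  [∀ N, IsProbabilityMeasure (P N)]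

/-- The limit of the characteristic functions of the normalized errors of the empirical
probability vectors. -/
lemma IsMultinomial.tendsto_charFun {ι : Type*} [Fintype ι] {p : ι → ℝ}
    {n : (N : ℕ) → Ω N → ι → ℕ} (h : ∀ N, IsMultinomial (P N) N p (n N)) (hp : ∀ j, 0 ≤ p j)
    (hs : ∑ j, p j = 1) (t : EuclideanSpace ℝ ι) :
    Tendsto (fun N : ℕ => charFun ((P N).map fun ω => √(N : ℝ) • empiricalError p (n N ω)) t) atTop
      (𝓝 (Complex.exp (-(∑ j, p j * t j ^ 2 - (∑ j, p j * t j) ^ 2 : ℝ) / 2))) := by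
  have hx : ∑ j, p j * (t j - ∑ i, p i * t i) = 0 := by
    simp only [mul_sub, Finset.sum_sub_distrib]
    rw [← Finset.sum_mul, hs, one_mul, sub_self]
  have key := tendsto_sum_cexp_pow hs hx
  have e : ∑ j, p j * (t j - ∑ i, p i * t i) ^ 2
      = ∑ j, p j * t j ^ 2 - (∑ j, p j * t j) ^ 2 := by
    set c := ∑ i, p i * t i with hc
    have : ∀ j, p j * (t j - c) ^ 2 = p j * t j ^ 2 - 2 * c * (p j * t j) + c ^ 2 * p j :=
      fun j => by ring
    simp only [this, Finset.sum_add_distrib, Finset.sum_sub_distrib, ← Finset.mul_sum, hs, ← hc]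
    ring
  rw [e] at key
  refine key.congr' ?_
  filter_upwards [eventually_gt_atTop 0] with N hN
  rw [(h N).charFun_sqrt_smul_empiricalError hp hs hN t]

/-- The normalized errors of the empirical probability vectors are bounded in probability. -/
lemma IsMultinomial.exists_measure_norm_gt_le {ι : Type*} [Fintype ι] {p : ι → ℝ}
    {n : (N : ℕ) → Ω N → ι → ℕ} (h : ∀ N, IsMultinomial (P N) N p (n N)) (hp : ∀ j, 0 ≤ p j)
    (hs : ∑ j, p j = 1) {ε : ENNReal} (hε : 0 < ε) :
    ∃ M : ℝ, 0 < M ∧ ∀ N, P N {ω | M < ‖√(N : ℝ) • empiricalError p (n N ω)‖} ≤ ε := by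
  have hm : ∀ N : ℕ, AEMeasurable (fun ω => √(N : ℝ) • empiricalError p (n N ω)) (P N) :=
    fun N => (h N).aemeasurable_smul_empiricalError _
  have : ∀ N : ℕ, IsProbabilityMeasure
      ((P N).map fun ω => √(N : ℝ) • empiricalError p (n N ω)) :=
    fun N => Measure.isProbabilityMeasure_map (hm N)
  -- Continuity at 0 of the limiting characteristic function gives tightness of the whole sequence,
  -- hence a bound valid for every N.
  have hc : ContinuousAt (fun t : EuclideanSpace ℝ ι =>
      Complex.exp (-(∑ j, p j * t j ^ 2 - (∑ j, p j * t j) ^ 2 : ℝ) / 2)) 0 := by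
    apply Continuous.continuousAt
    fun_prop
  obtain ⟨K, hK, hK'⟩ := isTightMeasureSet_iff_exists_isCompact_measure_compl_le.1
    (isTightMeasureSet_of_tendsto_charFun hc (IsMultinomial.tendsto_charFun h hp hs)) ε hε
  obtain ⟨M, hM0, hM⟩ := hK.isBounded.exists_pos_norm_le
  refine ⟨M, hM0, fun N => ?_⟩
  refine le_trans ?_ (hK' _ ⟨N, rfl⟩)
  rw [Measure.map_apply_of_aemeasurable (hm N) hK.measurableSet.compl]
  refine measure_mono fun ω hω hmem => ?_
  exact absurd (hM _ hmem) (not_le.2 hω)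

/-! ### Negligible perturbations and the delta method. -/

variable {E : Type*} [NormedAddCommGroup E] [InnerProductSpace ℝ E] [MeasurableSpace E]
  [BorelSpace E]

lemma norm_cexp_sub_cexp_le (a b : ℝ) :
    ‖Complex.exp (a * Complex.I) - Complex.exp (b * Complex.I)‖ ≤ |a - b| := by
  have : Complex.exp (a * Complex.I) - Complex.exp (b * Complex.I)
      = Complex.exp (b * Complex.I) * (Complex.exp (Complex.I * (a - b : ℝ)) - 1) := by
    rw [mul_sub, mul_one, ← Complex.exp_add]
    congr 2
    push_cast
    ring
  rw [this, norm_mul, Complex.norm_exp_ofReal_mul_I, one_mul]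
  exact Real.norm_exp_I_mul_ofReal_sub_one_le

/-- Characteristic functions of random vectors whose difference tends to zero in probability have
the same limits. -/
lemma tendsto_charFun_of_sub_tendsto_zero [SecondCountableTopology E] {X Y : (N : ℕ) → Ω N → E}
    (hX : ∀ N, AEMeasurable (X N) (P N)) (hY : ∀ N, AEMeasurable (Y N) (P N)) {t : E} {c : ℂ}
    (hlim : Tendsto (fun N => charFun ((P N).map (X N)) t) atTop (𝓝 c))
    (hXY : ∀ η > 0, Tendsto (fun N => P N {ω | η < ‖Y N ω - X N ω‖}) atTop (𝓝 0)) :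
    Tendsto (fun N => charFun ((P N).map (Y N)) t) atTop (𝓝 c) := by
  have hsub : Tendsto (fun N => charFun ((P N).map (Y N)) t - charFun ((P N).map (X N)) t) atTop
      (𝓝 0) := by
    rw [Metric.tendsto_atTop']
    intro ε hε
    -- Where the difference is at most η the integrands differ by at most η‖t‖ < ε/2; the
    -- exceptional event has probability below ε/4 and costs at most 2 there.
    obtain ⟨η, hη, hηε⟩ : ∃ η > 0, η * ‖t‖ < ε / 2 := by
      refine ⟨ε / 2 / (‖t‖ + 1), by positivity, ?_⟩
      rw [div_mul_eq_mul_div, div_lt_iff₀ (by positivity)]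
      nlinarith [norm_nonneg t]
    have hev : ∀ᶠ N in atTop, (P N).real {ω | η < ‖Y N ω - X N ω‖} < ε / 4 := by
      have := (ENNReal.tendsto_toReal ENNReal.zero_ne_top).comp (hXY η hη)
      exact this.eventually (gt_mem_nhds (by simpa using by positivity))
    obtain ⟨N₀, hN₀⟩ := eventually_atTop.1 hev
    refine ⟨N₀, fun N hN => ?_⟩
    specialize hN₀ N hN.le
    rw [dist_zero_right, charFun_map_eq_integral (hY N), charFun_map_eq_integral (hX N),
      ← integral_sub]
    · set A := {ω | η < ‖Y N ω - X N ω‖} with hA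
      have hAm : NullMeasurableSet A (P N) :=
        nullMeasurableSet_lt aemeasurable_const ((hY N).sub (hX N)).norm
      have hbound : ∀ ω, ‖Complex.exp ((inner ℝ (Y N ω) t : ℝ) * Complex.I)
          - Complex.exp ((inner ℝ (X N ω) t : ℝ) * Complex.I)‖
          ≤ η * ‖t‖ + A.indicator (fun _ => (2 : ℝ)) ω := by
        intro ω
        by_cases hω : ω ∈ A
        · rw [Set.indicator_of_mem hω]
          have := norm_sub_le (Complex.exp ((inner ℝ (Y N ω) t : ℝ) * Complex.I))
            (Complex.exp ((inner ℝ (X N ω) t : ℝ) * Complex.I))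
          rw [Complex.norm_exp_ofReal_mul_I, Complex.norm_exp_ofReal_mul_I] at this
          have h0 : 0 ≤ η * ‖t‖ := by positivity
          linarith
        · rw [Set.indicator_of_notMem hω, add_zero]
          refine (norm_cexp_sub_cexp_le _ _).trans ?_
          rw [← inner_sub_left]
          refine (abs_real_inner_le_norm _ _).trans ?_
          gcongr
          exact not_lt.1 hω
      refine (norm_integral_le_integral_norm _).trans_lt ?_
      have hint : Integrable (fun ω => η * ‖t‖ + A.indicator (fun _ => (2 : ℝ)) ω) (P N) :=
        (integrable_const _).add ((integrable_const _).indicator₀ hAm)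
      refine (integral_mono_of_nonneg (ae_of_all _ fun _ => norm_nonneg _) hint
        (ae_of_all _ hbound)).trans_lt ?_
      rw [integral_add (integrable_const _) ((integrable_const _).indicator₀ hAm),
        integral_indicator₀ hAm]
      simp only [integral_const, probReal_univ, smul_eq_mul, one_mul,
        measureReal_restrict_apply_univ]
      linarith
    all_goals
      refine Integrable.of_bound (C := 1) ?_
        (ae_of_all _ fun ω => by rw [Complex.norm_exp_ofReal_mul_I])
      have hXN := hX N
      have hYN := hY N
      exact AEMeasurable.aestronglyMeasurable (by fun_prop)
  simpa using hsub.add hlim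

/-- The delta method for multinomial counts: an estimator which is, for empirical probability
vectors near `p`, a differentiable function of the empirical probability vector up to an error of
smaller order, is asymptotically normal. -/
theorem IsMultinomial.tendstoInDistribution_of_linear_approx {ι κ : Type*} [Fintype ι] [Fintype κ]
    [DecidableEq κ] {p : ι → ℝ} {n : (N : ℕ) → Ω N → ι → ℕ}
    (h : ∀ N, IsMultinomial (P N) N p (n N)) (hp : ∀ j, 0 ≤ p j) (hs : ∑ j, p j = 1)
    (T : EuclideanSpace ℝ ι →L[ℝ] EuclideanSpace ℝ κ) {Y : (N : ℕ) → Ω N → EuclideanSpace ℝ κ}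
    {θ₀ : EuclideanSpace ℝ κ} (hY : ∀ N, AEMeasurable (Y N) (P N))
    (happrox : ∀ ε > 0, ∃ δ > 0, ∀ᶠ N in atTop, ∀ᵐ ω ∂(P N),
      ‖empiricalError p (n N ω)‖ < δ →
        ‖Y N ω - θ₀ - T (empiricalError p (n N ω))‖ ≤ ε * ‖empiricalError p (n N ω)‖)
    {C : Matrix κ κ ℝ} (hC : C.PosSemidef)
    (hCT : ∀ t : EuclideanSpace ℝ κ, t.ofLp ⬝ᵥ C.mulVec t.ofLp
      = ∑ j, p j * (ContinuousLinearMap.adjoint T t) j ^ 2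
        - (∑ j, p j * (ContinuousLinearMap.adjoint T t) j) ^ 2) :
    TendstoInDistribution (fun (N : ℕ) ω => √(N : ℝ) • (Y N ω - θ₀)) atTop id P
      (multivariateGaussian 0 C) := by
  have hm : ∀ N : ℕ, AEMeasurable (fun ω => √(N : ℝ) • empiricalError p (n N ω)) (P N) :=
    fun N => (h N).aemeasurable_smul_empiricalError _
  have hY' : ∀ N : ℕ, AEMeasurable (fun ω => √(N : ℝ) • (Y N ω - θ₀)) (P N) :=
    fun N => ((hY N).sub_const θ₀).fun_const_smul _
  have hX' : ∀ N : ℕ, AEMeasurable (fun ω => T (√(N : ℝ) • empiricalError p (n N ω))) (P N) :=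
    fun N => T.measurable.comp_aemeasurable (hm N)
  refine ⟨hY', aemeasurable_id, ?_⟩
  refine ProbabilityMeasure.tendsto_iff_tendsto_charFun.2 fun t => ?_
  simp only [ProbabilityMeasure.coe_mk, Measure.map_id]
  rw [charFun_multivariateGaussian hC]
  have hlim : Tendsto (fun N : ℕ => charFun
      ((P N).map fun ω => T (√(N : ℝ) • empiricalError p (n N ω))) t) atTop
      (𝓝 (Complex.exp ((inner ℝ t (0 : EuclideanSpace ℝ κ) : ℝ) * Complex.I
        - (t.ofLp ⬝ᵥ C.mulVec t.ofLp : ℝ) / 2))) := by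
    have := IsMultinomial.tendsto_charFun h hp hs (ContinuousLinearMap.adjoint T t)
    rw [← hCT] at this
    simp only [inner_zero_right, Complex.ofReal_zero, zero_mul, zero_sub, ← neg_div]
    refine this.congr fun N => ?_
    rw [charFun_map_eq_integral (hm N), charFun_map_eq_integral (hX' N)]
    simp only [ContinuousLinearMap.adjoint_inner_right]
  refine tendsto_charFun_of_sub_tendsto_zero hX' hY' hlim fun η hη => ?_
  rw [ENNReal.tendsto_nhds_zero]
  intro ε hε
  have hε2 : 0 < ε / 2 := ENNReal.half_pos hε.ne'
  obtain ⟨M, hM0, hM⟩ := IsMultinomial.exists_measure_norm_gt_le h hp hs hε2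
  -- If √N times the empirical error is at most M and √N > M/δ, then the error is below δ, and the
  -- scaled remainder is at most (η/M) · M = η.
  obtain ⟨δ, hδ, hap⟩ := happrox (η / M) (by positivity)
  have hsq : Tendsto (fun N : ℕ => √(N : ℝ)) atTop atTop :=
    Real.tendsto_sqrt_atTop.comp tendsto_natCast_atTop_atTop
  filter_upwards [hap, hsq.eventually_gt_atTop (M / δ)] with N hN hNδ
  refine le_trans (measure_mono_ae ?_) ((hM N).trans ENNReal.half_le_self)
  filter_upwards [hN] with ω hω hmem
  change η < ‖√(N : ℝ) • (Y N ω - θ₀) - T (√(N : ℝ) • empiricalError p (n N ω))‖ at hmem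
  change M < ‖√(N : ℝ) • empiricalError p (n N ω)‖
  by_contra hcon
  rw [not_lt, norm_smul, Real.norm_of_nonneg (Real.sqrt_nonneg _)] at hcon
  have hs0 : 0 < √(N : ℝ) := lt_trans (by positivity) hNδ
  have hlt : ‖empiricalError p (n N ω)‖ < δ := by
    rw [div_lt_iff₀ hδ] at hNδ
    nlinarith [norm_nonneg (empiricalError p (n N ω))]
  have := hω hlt
  rw [map_smul, ← smul_sub, norm_smul, Real.norm_of_nonneg hs0.le] at hmem
  have h2 : √(N : ℝ) * ‖Y N ω - θ₀ - T (empiricalError p (n N ω))‖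
      ≤ η / M * (√(N : ℝ) * ‖empiricalError p (n N ω)‖) := by
    nlinarith
  have h3 : η / M * (√(N : ℝ) * ‖empiricalError p (n N ω)‖) ≤ η / M * M := by gcongr
  rw [div_mul_cancel₀ _ hM0.ne'] at h3
  linarith

end Sequences

/-! ### The density power divergence -/

/-- One term of the density power divergence, normalized so as to be nonnegative. -/
def dpdTerm (β p q : ℝ) : ℝ :=
  if β = 0 then p * Real.log (p / q) - p + q
  else q ^ (β + 1) - (1 + 1 / β) * (q ^ β * p) + 1 / β * p ^ (β + 1)

/-- At β = 0 a single summand p log(p/q) can be negative. The correction q - p cancels between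
vectors of equal total and makes every term nonnegative. -/
lemma dpd_eq_sum_dpdTerm {ι : Type*} [Fintype ι] (β : ℝ) {p q : ι → ℝ}
    (h : ∑ j, p j = ∑ j, q j) : dpd β p q = ∑ j, dpdTerm β (p j) (q j) := by
  unfold dpd dpdTerm
  split_ifs with hβ
  · rw [Finset.sum_add_distrib, Finset.sum_sub_distrib, h, sub_add_cancel]
  · rfl

lemma dpdTerm_self {β p : ℝ} (hp : 0 < p) : dpdTerm β p p = 0 := by
  unfold dpdTerm
  split_ifs with hβ
  · rw [div_self hp.ne', Real.log_one]; ring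
  · rw [Real.rpow_add hp, Real.rpow_one]; ring

/-- One formula covers all β, including 0. Its sign is that of q - p for β ≥ 0, which gives
monotonicity on both sides of p; its factor q^(β-1) is the source of the weight D^(β-1) in J_β. -/
lemma hasDerivAt_dpdTerm {β p q : ℝ} (hp : 0 < p) (hq : 0 < q) :
    HasDerivAt (dpdTerm β p) ((β + 1) * q ^ (β - 1) * (q - p)) q := by
  by_cases hβ : β = 0
  · subst hβ
    have h1 : HasDerivAt (fun x : ℝ => p * (Real.log p - Real.log x) - p + x)
        (p * (0 - q⁻¹) - 0 + 1) q :=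
      ((((hasDerivAt_const q (Real.log p)).sub (Real.hasDerivAt_log hq.ne')).const_mul p).sub
        (hasDerivAt_const q p)).add (hasDerivAt_id q)
    have h2 : dpdTerm 0 p =ᶠ[𝓝 q] fun x : ℝ => p * (Real.log p - Real.log x) - p + x := by
      filter_upwards [lt_mem_nhds hq] with x hx
      simp [dpdTerm, Real.log_div hp.ne' hx.ne']
    have e : (0 + 1) * q ^ ((0 : ℝ) - 1) * (q - p) = p * (0 - q⁻¹) - 0 + 1 := by
      rw [zero_sub, Real.rpow_neg_one]
      field_simp
      ring
    rw [e]
    exact h1.congr_of_eventuallyEq h2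
  · have h1 : HasDerivAt (fun x : ℝ => x ^ (β + 1) - (1 + 1 / β) * (x ^ β * p)
        + 1 / β * p ^ (β + 1)) ((β + 1) * q ^ (β + 1 - 1)
          - (1 + 1 / β) * (β * q ^ (β - 1) * p)) q :=
      ((Real.hasDerivAt_rpow_const (Or.inl hq.ne')).sub
        (((Real.hasDerivAt_rpow_const (Or.inl hq.ne')).mul_const p).const_mul _)).add_const _
    have h2 : dpdTerm β p = fun x : ℝ => x ^ (β + 1) - (1 + 1 / β) * (x ^ β * p)
        + 1 / β * p ^ (β + 1) := by
      funext x
      simp [dpdTerm, hβ]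
    have e : (β + 1) * q ^ (β - 1) * (q - p)
        = (β + 1) * q ^ (β + 1 - 1) - (1 + 1 / β) * (β * q ^ (β - 1) * p) := by
      have : q ^ (β + 1 - 1) = q ^ (β - 1) * q := by
        rw [← Real.rpow_add_one hq.ne']; ring_nf
      rw [this]
      field_simp
    rw [h2, e]
    exact h1

lemma dpdTerm_antitoneOn {β p : ℝ} (hβ : 0 ≤ β) (hp : 0 < p) :
    AntitoneOn (dpdTerm β p) (Set.Ioc 0 p) := by
  refine antitoneOn_of_deriv_nonpos (convex_Ioc 0 p)
    (fun q hq => (hasDerivAt_dpdTerm hp hq.1).continuousAt.continuousWithinAt) ?_ ?_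
  · intro q hq
    rw [interior_Ioc] at hq
    exact (hasDerivAt_dpdTerm hp hq.1).differentiableAt.differentiableWithinAt
  · intro q hq
    rw [interior_Ioc] at hq
    rw [(hasDerivAt_dpdTerm hp hq.1).deriv]
    have := Real.rpow_pos_of_pos hq.1 (β - 1)
    exact mul_nonpos_of_nonneg_of_nonpos (by positivity) (by linarith [hq.2])

lemma dpdTerm_monotoneOn {β p : ℝ} (hβ : 0 ≤ β) (hp : 0 < p) :
    MonotoneOn (dpdTerm β p) (Set.Ici p) := by
  refine monotoneOn_of_deriv_nonneg (convex_Ici p)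
    (fun q hq => (hasDerivAt_dpdTerm hp (hp.trans_le hq)).continuousAt.continuousWithinAt) ?_ ?_
  · intro q hq
    rw [interior_Ici] at hq
    exact (hasDerivAt_dpdTerm hp (hp.trans hq)).differentiableAt.differentiableWithinAt
  · intro q hq
    rw [interior_Ici] at hq
    rw [(hasDerivAt_dpdTerm hp (hp.trans hq)).deriv]
    have := Real.rpow_pos_of_pos (hp.trans hq) (β - 1)
    exact mul_nonneg (by positivity) (by linarith [Set.mem_Ioi.1 hq])

lemma dpdTerm_nonneg {β p q : ℝ} (hβ : 0 ≤ β) (hp : 0 < p) (hq : 0 < q) : 0 ≤ dpdTerm β p q := by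
  rw [← dpdTerm_self (β := β) hp]
  rcases le_total q p with h | h
  · exact dpdTerm_antitoneOn hβ hp ⟨hq, h⟩ ⟨hp, le_rfl⟩ h
  · exact dpdTerm_monotoneOn hβ hp Set.self_mem_Ici h h

/-- The second order expansion of the terms of the density power divergence. -/
lemma exists_dpdTerm_expansion (β : ℝ) {r ε : ℝ} (hr : 0 < r) (hε : 0 < ε) :
    ∃ δ > 0, ∀ p q : ℝ, |p - r| < δ → |q - r| < δ →
      |dpdTerm β p q - (β + 1) / 2 * r ^ (β - 1) * (q - p) ^ 2| ≤ ε * (q - p) ^ 2 := by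
  have hc : ContinuousAt (fun q : ℝ => (β + 1) * q ^ (β - 1)) r :=
    (Real.continuousAt_rpow_const r (β - 1) (Or.inl hr.ne')).const_mul _
  obtain ⟨δ, hδ, h⟩ := Metric.continuousAt_iff.1 hc ε hε
  refine ⟨min δ r, lt_min hδ hr, fun p q hp hq => ?_⟩
  have hpos : ∀ x : ℝ, |x - r| < min δ r → 0 < x := fun x hx => by
    have := (abs_lt.1 (hx.trans_le (min_le_right _ _))).1
    linarith
  have hp0 := hpos p hp
  -- The difference g vanishes at p. Between p and q its derivative is at most ε|q - p|, by
  -- continuity of x^(β-1) at r, so the mean value inequality gives the quadratic bound. The radius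
  -- is at most r to keep all points positive.
  set g : ℝ → ℝ := fun x => dpdTerm β p x - (β + 1) / 2 * r ^ (β - 1) * (x - p) ^ 2 with hg
  have hseg : ∀ x ∈ Set.uIcc p q, |x - r| < min δ r := by
    intro x hx
    have h1 : p ∈ Metric.ball r (min δ r) := by rwa [Metric.mem_ball, Real.dist_eq]
    have h2 : q ∈ Metric.ball r (min δ r) := by rwa [Metric.mem_ball, Real.dist_eq]
    have h3 := (convex_ball r (min δ r)).segment_subset h1 h2
    rw [segment_eq_uIcc] at h3
    have := h3 hx
    rwa [Metric.mem_ball, Real.dist_eq] at this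
  have hderiv : ∀ x ∈ Set.uIcc p q, HasDerivWithinAt g
      ((β + 1) * x ^ (β - 1) * (x - p) - (β + 1) / 2 * r ^ (β - 1) * (2 * (x - p)))
      (Set.uIcc p q) x := by
    intro x hx
    have h1 : HasDerivAt (fun x : ℝ => (x - p) ^ 2) (2 * (x - p)) x := by
      simpa using ((hasDerivAt_id x).sub_const p).fun_pow 2
    exact ((hasDerivAt_dpdTerm hp0 (hpos x (hseg x hx))).sub (h1.const_mul _)).hasDerivWithinAt
  have hbound : ∀ x ∈ Set.uIcc p q,
      ‖(β + 1) * x ^ (β - 1) * (x - p) - (β + 1) / 2 * r ^ (β - 1) * (2 * (x - p))‖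
        ≤ ε * |q - p| := by
    intro x hx
    have e : (β + 1) * x ^ (β - 1) * (x - p) - (β + 1) / 2 * r ^ (β - 1) * (2 * (x - p))
        = ((β + 1) * x ^ (β - 1) - (β + 1) * r ^ (β - 1)) * (x - p) := by ring
    rw [e, norm_mul]
    have h1 := h (x := x) (by rw [Real.dist_eq]; exact (hseg x hx).trans_le (min_le_left _ _))
    rw [Real.dist_eq] at h1
    refine mul_le_mul h1.le ?_ (abs_nonneg _) hε.le
    exact Set.abs_sub_left_of_mem_uIcc hx
  have := (convex_uIcc p q).norm_image_sub_le_of_norm_hasDerivWithin_le hderiv hbound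
    Set.left_mem_uIcc Set.right_mem_uIcc
  have hgp : g p = 0 := by simp [hg, dpdTerm_self hp0]
  rw [hgp, sub_zero, Real.norm_eq_abs, Real.norm_eq_abs] at this
  rw [← sq_abs (q - p)]
  calc _ ≤ ε * |q - p| * |q - p| := by simpa [hg] using this
    _ = _ := by ring

/-- Monotonicity away from p reduces every remote q, however large or close to 0, to one of the two
points r ± s, where the quadratic expansion applies with half its coefficient. The bound is uniform
in q because Θ is not compact. -/
lemma exists_le_dpdTerm {β r ε : ℝ} (hβ : 0 ≤ β) (hr : 0 < r) (hε : 0 < ε) :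
    ∃ c > 0, ∃ δ > 0, ∀ p q : ℝ, |p - r| < δ → 0 < q → ε ≤ |q - r| → c ≤ dpdTerm β p q := by
  set A : ℝ := (β + 1) / 2 * r ^ (β - 1) with hA
  have hApos : 0 < A := by have := Real.rpow_pos_of_pos hr (β - 1); positivity
  obtain ⟨δ, hδ, h⟩ := exists_dpdTerm_expansion β hr (half_pos hApos)
  obtain ⟨s, hs0, hsε, hsδ, hsr⟩ : ∃ s > 0, s ≤ ε ∧ s < δ ∧ s < r := by
    refine ⟨min ε (min (δ / 2) (r / 2)), by positivity, min_le_left _ _, ?_, ?_⟩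
    · exact ((min_le_right _ _).trans (min_le_left _ _)).trans_lt (by linarith)
    · exact ((min_le_right _ _).trans (min_le_right _ _)).trans_lt (by linarith)
  refine ⟨A / 2 * (s / 2) ^ 2, by positivity, s / 2, by positivity, fun p q hp hq hqr => ?_⟩
  have hp' := abs_lt.1 hp
  have hp0 : 0 < p := by linarith
  have key : ∀ q' : ℝ, |q' - r| = s → s / 2 ≤ |q' - p| → A / 2 * (s / 2) ^ 2 ≤ dpdTerm β p q' := by
    intro q' hq' hqp
    have h1 := (abs_le.1 (h p q' (by linarith) (by linarith))).1
    rw [← hA] at h1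
    have h2 : (s / 2) ^ 2 ≤ (q' - p) ^ 2 := by
      rw [← sq_abs (q' - p)]
      gcongr
    nlinarith
  rcases le_abs.1 (hsε.trans hqr) with h1 | h1
  · refine (key (r + s) (by rw [add_sub_cancel_left, abs_of_pos hs0]) ?_).trans
      (dpdTerm_monotoneOn hβ hp0 ?_ ?_ ?_)
    · exact le_trans (by linarith) (le_abs_self _)
    · exact Set.mem_Ici.2 (by linarith)
    · exact Set.mem_Ici.2 (by linarith)
    · linarith
  · refine (key (r - s) ?_ ?_).trans (dpdTerm_antitoneOn hβ hp0 ?_ ?_ ?_)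
    · rw [sub_sub_cancel_left, abs_neg, abs_of_pos hs0]
    · exact le_trans (by linarith) (neg_le_abs _)
    · exact ⟨hq, by linarith⟩
    · exact ⟨by linarith, by linarith⟩
    · linarith

lemma tendsto_dpdTerm_self {β r : ℝ} (hr : 0 < r) :
    Tendsto (fun p => dpdTerm β p r) (𝓝 r) (𝓝 0) := by
  obtain ⟨δ, hδ, h⟩ := exists_dpdTerm_expansion β hr one_pos
  rw [tendsto_zero_iff_abs_tendsto_zero]
  have hb : Tendsto (fun p : ℝ => (|(β + 1) / 2 * r ^ (β - 1)| + 1) * (r - p) ^ 2) (𝓝 r) (𝓝 0) := by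
    have : Continuous fun p : ℝ => (|(β + 1) / 2 * r ^ (β - 1)| + 1) * (r - p) ^ 2 := by fun_prop
    simpa using this.tendsto r
  refine squeeze_zero' (Eventually.of_forall fun _ => abs_nonneg _) ?_ hb
  filter_upwards [Metric.ball_mem_nhds r hδ] with p hp
  rw [Metric.mem_ball, Real.dist_eq] at hp
  have h1 := h p r hp (by simpa using hδ)
  have h2 := abs_sub_abs_le_abs_sub (dpdTerm β p r) ((β + 1) / 2 * r ^ (β - 1) * (r - p) ^ 2)
  rw [abs_mul _ ((r - p) ^ 2), abs_of_nonneg (sq_nonneg (r - p))] at h2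
  simp only [Function.comp]
  linarith

/-- Probability vectors whose divergence from `p` is at most that of `r` are close to `r` if `p`
is close to `r`. -/
lemma eventually_close_of_dpd_le {ι : Type*} [Fintype ι] {β : ℝ} (hβ : 0 ≤ β) {r : ι → ℝ}
    (hr : ∀ j, 0 < r j) (hr1 : ∑ j, r j = 1) {ε : ℝ} (hε : 0 < ε) :
    ∀ᶠ p in 𝓝 r, ∑ j, p j = 1 → ∀ q : ι → ℝ, (∀ j, 0 < q j) → ∑ j, q j = 1 →
      dpd β p q ≤ dpd β p r → ∀ j, |q j - r j| < ε := by
  choose c hc δ hδ h using fun j => exists_le_dpdTerm hβ (hr j) hε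
  have hlim : Tendsto (fun p : ι → ℝ => ∑ j, dpdTerm β (p j) (r j)) (𝓝 r) (𝓝 0) := by
    have : Tendsto (fun p : ι → ℝ => ∑ j, dpdTerm β (p j) (r j)) (𝓝 r) (𝓝 (∑ _j : ι, (0 : ℝ))) :=
      tendsto_finsetSum _ fun j _ => (tendsto_dpdTerm_self (hr j)).comp
        ((continuous_apply j).tendsto r)
    simpa using this
  have e1 : ∀ᶠ p in 𝓝 r, ∀ j, ∑ i, dpdTerm β (p i) (r i) < c j :=
    eventually_all.2 fun j => hlim.eventually (gt_mem_nhds (hc j))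
  have e2 : ∀ᶠ p in 𝓝 r, ∀ j, |p j - r j| < δ j := eventually_all.2 fun j =>
    ((continuous_apply j).tendsto r).eventually (Metric.ball_mem_nhds (r j) (hδ j))
  have e3 : ∀ᶠ p in 𝓝 r, ∀ j, 0 < p j := eventually_all.2 fun j =>
    ((continuous_apply j).tendsto r).eventually (lt_mem_nhds (hr j))
  filter_upwards [e1, e2, e3] with p h1 h2 h3 hp q hq hq1 hle j
  rw [dpd_eq_sum_dpdTerm β (hp.trans hq1.symm), dpd_eq_sum_dpdTerm β (hp.trans hr1.symm)] at hle
  by_contra hcon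
  -- A single remote coordinate already contributes c_j; the other terms are nonnegative, while the
  -- total is at most the divergence from p to r, which is below c_j.
  have h4 := h j (p j) (q j) (h2 j) (hq j) (not_lt.1 hcon)
  have h5 : dpdTerm β (p j) (q j) ≤ ∑ i, dpdTerm β (p i) (q i) :=
    Finset.single_le_sum (f := fun i => dpdTerm β (p i) (q i))
      (fun i _ => dpdTerm_nonneg hβ (h3 i) (hq i)) (Finset.mem_univ j)
  linarith [h1 j]

lemma continuousOn_dpd {ι : Type*} [Fintype ι] (β : ℝ) {p : ι → ℝ} (hp : ∀ j, 0 < p j) :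
    ContinuousOn (fun q : ι → ℝ => ∑ j, dpdTerm β (p j) (q j)) {q | ∀ j, 0 < q j} := by
  refine continuousOn_finsetSum _ fun j _ q hq => ?_
  exact (ContinuousAt.comp' (f := fun q : ι → ℝ => q j) (x := q)
    (hasDerivAt_dpdTerm (hp j) (hq j)).continuousAt
    (continuous_apply j).continuousAt).continuousWithinAt

/-! ### Differentiability of the minimum distance functional -/

/-- If the distances of `A - r` and `B - r'` from the origin are nearly in the wrong order, where
`B` is the orthogonal projection of the origin to a subspace through `A = B - v`, then `v` is
small. -/
lemma norm_sq_le_of_near_projection {F : Type*} [NormedAddCommGroup F] [InnerProductSpace ℝ F]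
    {B v r r' : F} {ε M : ℝ} (hε : 0 ≤ ε) (hε1 : ε ≤ 1) (horth : inner ℝ B v = 0)
    (hA : ‖B - v‖ ≤ M) (hB : ‖B‖ ≤ M) (hr : ‖r‖ ≤ ε * M) (hr' : ‖r'‖ ≤ ε * M)
    (h : ‖B - v - r‖ ^ 2 - ‖B - r'‖ ^ 2 ≤ ε * ‖B - v - r‖ ^ 2 + ε * ‖B - r'‖ ^ 2) :
    ‖v‖ ^ 2 ≤ 13 * ε * M ^ 2 := by
  have hM : 0 ≤ M := (norm_nonneg _).trans hB
  -- By Pythagoras ‖v‖² is the gap between the unperturbed squared distances. The constant is 13 = 2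
  -- + 3 + 4 + 4: perturbation by r, perturbation by r', and the two terms ε(2M)².
  have hpyth : ‖B - v‖ ^ 2 = ‖B‖ ^ 2 + ‖v‖ ^ 2 := by rw [norm_sub_sq_real, horth]; ring
  have hεM : ε * M ≤ M := mul_le_of_le_one_left hM hε1
  have h1 : ‖B - v - r‖ ^ 2 ≤ (2 * M) ^ 2 := by
    have : ‖B - v - r‖ ≤ 2 * M := (norm_sub_le _ _).trans (by linarith)
    gcongr
  have h2 : ‖B - r'‖ ^ 2 ≤ (2 * M) ^ 2 := by
    have : ‖B - r'‖ ≤ 2 * M := (norm_sub_le _ _).trans (by linarith)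
    gcongr
  have h3 : ‖B - v‖ ^ 2 - 2 * (ε * M ^ 2) ≤ ‖B - v - r‖ ^ 2 := by
    rw [norm_sub_sq_real (B - v) r]
    have h4 := (abs_le.1 (abs_real_inner_le_norm (B - v) r)).2
    have h5 : ‖B - v‖ * ‖r‖ ≤ M * (ε * M) := by gcongr
    have h6 := sq_nonneg ‖r‖
    linarith
  have h4 : ‖B - r'‖ ^ 2 ≤ ‖B‖ ^ 2 + 3 * (ε * M ^ 2) := by
    rw [norm_sub_sq_real]
    have h4 := (abs_le.1 (abs_real_inner_le_norm B r')).1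
    have h5 : ‖B‖ * ‖r'‖ ≤ M * (ε * M) := by gcongr
    have h6 : ‖r'‖ ^ 2 ≤ (ε * M) * M := by
      rw [sq]
      exact mul_le_mul hr' (hr'.trans hεM) (norm_nonneg _) (by positivity)
    linarith
  have h5 := mul_le_mul_of_nonneg_left h1 hε
  have h6 := mul_le_mul_of_nonneg_left h2 hε
  linarith

/-- Minimizers `θ i` of objective functions `D i` which behave like squared distances
`‖y i - f θ‖ ^ 2` are, to first order, least squares solutions. -/
theorem isLittleO_argmin_sub {ι E F : Type*} [NormedAddCommGroup E] [NormedSpace ℝ E]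
    [NormedAddCommGroup F] [InnerProductSpace ℝ F] {l : Filter ι} {y : ι → F} {f : E → F}
    {V : E →L[ℝ] F} {θ₀ : E} (hf : HasFDerivAt f V θ₀) (hf0 : f θ₀ = 0) {C : ℝ} (hC : 0 < C)
    (hV : ∀ h, ‖h‖ ≤ C * ‖V h‖) (T : F →L[ℝ] E) (horth : ∀ z h, inner ℝ (z - V (T z)) (V h) = 0)
    {D : ι → E → ℝ} {θ : ι → E} (hy : Tendsto y l (𝓝 0)) (hθ : Tendsto θ l (𝓝 θ₀))
    (hexp : ∀ ε > 0, ∃ U ∈ 𝓝 θ₀, ∀ᶠ i in l, ∀ θ' ∈ U,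
      |D i θ' - ‖y i - f θ'‖ ^ 2| ≤ ε * ‖y i - f θ'‖ ^ 2)
    (hmin : ∀ᶠ i in l, D i (θ i) ≤ D i θ₀ ∧ D i (θ i) ≤ D i (θ₀ + T (y i))) :
    (fun i => θ i - θ₀ - T (y i)) =o[l] y := by
  have hTy : Tendsto (fun i => θ₀ + T (y i)) l (𝓝 θ₀) := by
    have : Tendsto (fun i => θ₀ + T (y i)) l (𝓝 (θ₀ + T 0)) :=
      tendsto_const_nhds.add ((T.continuous.tendsto 0).comp hy)
    simpa using this
  have hr : (fun i => f (θ i) - V (θ i - θ₀)) =o[l] fun i => θ i - θ₀ := by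
    have := hf.isLittleO.comp_tendsto hθ
    simpa [Function.comp_def, hf0] using this
  have hr' : (fun i => f (θ₀ + T (y i)) - V (T (y i))) =o[l] y := by
    have := hf.isLittleO.comp_tendsto hTy
    simp only [Function.comp_def, hf0, sub_zero, add_sub_cancel_left] at this
    exact this.trans_isBigO (T.isBigO_comp y l)
  -- a first comparison, with `θ₀`, bounds the error
  have hh : ∀ᶠ i in l, ‖θ i - θ₀‖ ≤ 6 * C * ‖y i‖ := by
    obtain ⟨U, hU, hD⟩ := hexp (1 / 2) (by norm_num)
    filter_upwards [hD, hmin, hθ.eventually hU, hr.def (c := 1 / (2 * C)) (by positivity)]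
      with i hDi hm hθi hri
    have h1 := abs_le.1 (hDi _ hθi)
    have h2 := abs_le.1 (hDi _ (mem_of_mem_nhds hU))
    rw [hf0, sub_zero] at h2
    -- With relative error 1/2, comparison gives ‖y - f(θ)‖² ≤ 3‖y‖² ≤ (2‖y‖)², hence ‖f(θ)‖ ≤ 3‖y‖.
    -- Passing from f to V costs ‖θ - θ₀‖/2, which is absorbed on the left; this produces 6C.
    have h3 : ‖y i - f (θ i)‖ ^ 2 ≤ (2 * ‖y i‖) ^ 2 := by
      nlinarith [h1.1, h2.2, hm.1, sq_nonneg ‖y i‖]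
    have h4 : ‖y i - f (θ i)‖ ≤ 2 * ‖y i‖ := abs_le_of_sq_le_sq' h3 (by positivity) |>.2
    have h5 : ‖f (θ i)‖ ≤ 3 * ‖y i‖ := by
      have := norm_sub_norm_le (f (θ i)) (y i)
      rw [norm_sub_rev] at this
      linarith
    have h6 : ‖V (θ i - θ₀)‖ ≤ ‖f (θ i)‖ + ‖f (θ i) - V (θ i - θ₀)‖ := by
      have := norm_sub_norm_le (V (θ i - θ₀)) (f (θ i))
      rw [norm_sub_rev] at this
      linarith
    have h7 := hV (θ i - θ₀)
    have h8 : C * ‖V (θ i - θ₀)‖ ≤ C * (3 * ‖y i‖ + 1 / (2 * C) * ‖θ i - θ₀‖) := by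
      gcongr
      linarith
    have h9 : C * (3 * ‖y i‖ + 1 / (2 * C) * ‖θ i - θ₀‖) = 3 * C * ‖y i‖ + ‖θ i - θ₀‖ / 2 := by
      field_simp
    linarith
  have hrO : (fun i => f (θ i) - V (θ i - θ₀)) =o[l] y :=
    hr.trans_isBigO (Asymptotics.IsBigO.of_bound _ hh)
  -- K‖y‖ bounds the linearized residuals both of the minimizer and of the least squares solution.
  set K : ℝ := 1 + ‖V‖ * (6 * C) + ‖V‖ * ‖T‖ with hK
  have hK1 : 1 ≤ K := by
    have : 0 ≤ ‖V‖ * (6 * C) := by positivity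
    have : 0 ≤ ‖V‖ * ‖T‖ := by positivity
    linarith
  rw [Asymptotics.isLittleO_iff]
  intro c hc
  obtain ⟨ε, hε, hε1, hεc⟩ : ∃ ε > 0, ε ≤ 1 ∧ C ^ 2 * (13 * ε * K ^ 2) ≤ c ^ 2 := by
    refine ⟨min 1 (c ^ 2 / (C ^ 2 * 13 * K ^ 2)), by positivity, min_le_left _ _, ?_⟩
    calc C ^ 2 * (13 * min 1 (c ^ 2 / (C ^ 2 * 13 * K ^ 2)) * K ^ 2)
        ≤ C ^ 2 * (13 * (c ^ 2 / (C ^ 2 * 13 * K ^ 2)) * K ^ 2) := by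
          gcongr
          exact min_le_right _ _
      _ = c ^ 2 := by field_simp
  obtain ⟨U, hU, hD⟩ := hexp ε hε
  filter_upwards [hD, hmin, hθ.eventually hU, hTy.eventually hU, hrO.def hε, hr'.def hε, hh]
    with i hDi hm hθi hTi hri hri' hhi
  have h1 := (abs_le.1 (hDi _ hθi)).1
  have h2 := (abs_le.1 (hDi _ hTi)).2
  have ha0 : 0 ≤ ‖y i‖ := norm_nonneg _
  have haK : ‖y i‖ ≤ K * ‖y i‖ := le_mul_of_one_le_left ha0 hK1
  -- The minimizer's linearized residual is the least squares residual minus V applied to the error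
  -- to be estimated; these two are orthogonal.
  have eA : y i - V (θ i - θ₀) = y i - V (T (y i)) - V (θ i - θ₀ - T (y i)) := by
    rw [map_sub V _ (T (y i))]; abel
  have eA' : y i - f (θ i)
      = y i - V (T (y i)) - V (θ i - θ₀ - T (y i)) - (f (θ i) - V (θ i - θ₀)) := by
    rw [← eA]; abel
  have eB : y i - f (θ₀ + T (y i)) = y i - V (T (y i)) - (f (θ₀ + T (y i)) - V (T (y i))) := by abel
  have hAn : ‖y i - V (θ i - θ₀)‖ ≤ K * ‖y i‖ := by
    have h3 : ‖y i - V (θ i - θ₀)‖ ≤ ‖y i‖ + ‖V‖ * (6 * C * ‖y i‖) :=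
      (norm_sub_le _ _).trans (by gcongr; exact (V.le_opNorm _).trans (by gcongr))
    have h4 : 0 ≤ ‖V‖ * ‖T‖ * ‖y i‖ := by positivity
    rw [hK]; linarith
  have hBn : ‖y i - V (T (y i))‖ ≤ K * ‖y i‖ := by
    have h3 : ‖y i - V (T (y i))‖ ≤ ‖y i‖ + ‖V‖ * (‖T‖ * ‖y i‖) :=
      (norm_sub_le _ _).trans
        (by gcongr; exact (V.le_opNorm _).trans (by gcongr; exact T.le_opNorm _))
    have h4 : 0 ≤ ‖V‖ * (6 * C) * ‖y i‖ := by positivity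
    rw [hK]; linarith
  rw [eA] at hAn
  rw [eA'] at h1
  rw [eB] at h2
  have hw := norm_sq_le_of_near_projection hε.le hε1 (horth _ _) hAn hBn
    (hri.trans (by gcongr)) (hri'.trans (by gcongr)) (by linarith [hm.2])
  refine abs_le_of_sq_le_sq' ?_ (by positivity) |>.2
  calc ‖θ i - θ₀ - T (y i)‖ ^ 2 ≤ (C * ‖V (θ i - θ₀ - T (y i))‖) ^ 2 := by
        gcongr
        exact hV _
    _ = C ^ 2 * ‖V (θ i - θ₀ - T (y i))‖ ^ 2 := by ring
    _ ≤ C ^ 2 * (13 * ε * (K * ‖y i‖) ^ 2) := by gcongr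
    _ = C ^ 2 * (13 * ε * K ^ 2) * ‖y i‖ ^ 2 := by ring
    _ ≤ c ^ 2 * ‖y i‖ ^ 2 := by gcongr
    _ = (c * ‖y i‖) ^ 2 := by ring

/-- Coordinatewise multiplication by `w`. -/
def scaleCLM {ι : Type*} [Fintype ι] (w : ι → ℝ) : EuclideanSpace ℝ ι →L[ℝ] EuclideanSpace ℝ ι :=
  LinearMap.toContinuousLinearMap
    { toFun := fun z => WithLp.toLp 2 fun j => w j * z j
      map_add' := fun x y => by ext j; simp [mul_add]
      map_smul' := fun c x => by ext j; simp [mul_left_comm] }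

@[simp]
lemma scaleCLM_apply {ι : Type*} [Fintype ι] (w : ι → ℝ) (z : EuclideanSpace ℝ ι) (j : ι) :
    scaleCLM w z j = w j * z j := rfl

/-! ### Consistency, existence and first-order expansion of the minimizers. -/

section Argmin

variable {ι E : Type*} [Fintype ι] [NormedAddCommGroup E]
  {β : ℝ} {π : E → ι → ℝ} {Θ : Set E} {θ₀ : E}

/-- Consistency of the minimum density power divergence functional. -/
lemma eventually_norm_sub_lt_of_dpd_le (hβ : 0 ≤ β) (hθ₀ : θ₀ ∈ Θ)
    (hpos : ∀ θ ∈ Θ, ∀ j, 0 < π θ j) (hsum : ∀ θ ∈ Θ, ∑ j, π θ j = 1)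
    (hprop : ∀ ε > 0, ∃ η > 0, ∀ θ ∈ Θ, (∀ j, |π θ j - π θ₀ j| < η) → ‖θ - θ₀‖ < ε)
    {ε : ℝ} (hε : 0 < ε) :
    ∀ᶠ p in 𝓝 (π θ₀), ∑ j, p j = 1 → ∀ θ ∈ Θ, dpd β p (π θ) ≤ dpd β p (π θ₀) →
      ‖θ - θ₀‖ < ε := by
  obtain ⟨η, hη, h⟩ := hprop ε hε
  filter_upwards [eventually_close_of_dpd_le hβ (hpos θ₀ hθ₀) (hsum θ₀ hθ₀) hη]
    with p hp hp1 θ hθ hle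
  exact h θ hθ (hp hp1 (π θ) (hpos θ hθ) (hsum θ hθ) hle)

/-- Existence of minimum density power divergence estimates for probability vectors near the
model point `π θ₀`. -/
lemma eventually_exists_isMinOn_dpd [ProperSpace E] (hβ : 0 ≤ β) (hΘ : Θ ∈ 𝓝 θ₀)
    (hpos : ∀ θ ∈ Θ, ∀ j, 0 < π θ j) (hsum : ∀ θ ∈ Θ, ∑ j, π θ j = 1)
    (hprop : ∀ ε > 0, ∃ η > 0, ∀ θ ∈ Θ, (∀ j, |π θ j - π θ₀ j| < η) → ‖θ - θ₀‖ < ε)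
    (hcont : ContinuousOn π Θ) :
    ∀ᶠ p in 𝓝 (π θ₀), ∑ j, p j = 1 → ∃ θ ∈ Θ, IsMinOn (fun θ' => dpd β p (π θ')) Θ θ := by
  obtain ⟨ρ, hρ, hball⟩ := Metric.nhds_basis_closedBall.mem_iff.1 hΘ
  have hθ₀ : θ₀ ∈ Θ := mem_of_mem_nhds hΘ
  have e3 : ∀ᶠ p in 𝓝 (π θ₀), ∀ j, 0 < p j := eventually_all.2 fun j =>
    ((continuous_apply j).tendsto (π θ₀)).eventually (lt_mem_nhds (hpos θ₀ hθ₀ j))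
  filter_upwards [e3, eventually_norm_sub_lt_of_dpd_le hβ hθ₀ hpos hsum hprop hρ]
    with p hp hcons hp1
  have hcd : ContinuousOn (fun θ' => dpd β p (π θ')) (Metric.closedBall θ₀ ρ) := by
    refine ((continuousOn_dpd β hp).comp (hcont.mono hball)
      (fun θ hθ => hpos θ (hball hθ))).congr fun θ hθ => ?_
    exact dpd_eq_sum_dpdTerm β (hp1.trans (hsum θ (hball hθ)).symm)
  obtain ⟨θ₁, hθ₁, hmin⟩ := (isCompact_closedBall θ₀ ρ).exists_isMinOn
    ⟨θ₀, Metric.mem_closedBall_self hρ.le⟩ hcd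
  refine ⟨θ₁, hball hθ₁, fun θ hθ => ?_⟩
  by_cases hin : θ ∈ Metric.closedBall θ₀ ρ
  · exact hmin hin
  -- Outside the ball, consistency says that the divergence exceeds its value at θ₀, so the minimum
  -- over the ball is global.
  · refine (isMinOn_iff.1 hmin θ₀ (Metric.mem_closedBall_self hρ.le)).trans ?_
    by_contra hcon
    exact hin (by
      rw [Metric.mem_closedBall, dist_eq_norm]
      exact (hcons hp1 θ hθ (not_le.1 hcon).le).le)

/-- The minimum density power divergence functional is differentiable at the model point `π θ₀`;
its derivative is the weighted least squares solution operator `T`. -/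
lemma eventually_norm_argmin_sub_le [NormedSpace ℝ E] [FiniteDimensional ℝ E] (hβ : 0 ≤ β)
    (hΘ : Θ ∈ 𝓝 θ₀)
    (hpos : ∀ θ ∈ Θ, ∀ j, 0 < π θ j) (hsum : ∀ θ ∈ Θ, ∑ j, π θ j = 1)
    (hprop : ∀ ε > 0, ∃ η > 0, ∀ θ ∈ Θ, (∀ j, |π θ j - π θ₀ j| < η) → ‖θ - θ₀‖ < ε)
    {W : E →L[ℝ] EuclideanSpace ℝ ι}
    (hW : HasFDerivAt (fun θ => (WithLp.toLp 2 (π θ) : EuclideanSpace ℝ ι)) W θ₀)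
    (hinj : Function.Injective W) (T : EuclideanSpace ℝ ι →L[ℝ] E)
    (horth : ∀ z h, ∑ j, π θ₀ j ^ (β - 1) * (z j - W (T z) j) * W h j = 0)
    {ε : ℝ} (hε : 0 < ε) :
    ∀ᶠ p in 𝓝 (π θ₀), ∑ j, p j = 1 → ∀ θ ∈ Θ, IsMinOn (fun θ' => dpd β p (π θ')) Θ θ →
      ‖θ - θ₀ - T (WithLp.toLp 2 (p - π θ₀))‖
        ≤ ε * ‖(WithLp.toLp 2 (p - π θ₀) : EuclideanSpace ℝ ι)‖ := by
  have hθ₀ : θ₀ ∈ Θ := mem_of_mem_nhds hΘ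
  have hr := hpos θ₀ hθ₀
  -- Scaling by the square roots of the second-order coefficients turns the leading part of the
  -- divergence into a Euclidean squared norm.
  set w : ι → ℝ := fun j => √((β + 1) / 2 * π θ₀ j ^ (β - 1)) with hw
  have hwpos' : ∀ j, 0 < (β + 1) / 2 * π θ₀ j ^ (β - 1) := fun j => by
    have := Real.rpow_pos_of_pos (hr j) (β - 1)
    positivity
  have hwpos : ∀ j, 0 < w j := fun j => Real.sqrt_pos.2 (hwpos' j)
  have hwsq : ∀ j, w j ^ 2 = (β + 1) / 2 * π θ₀ j ^ (β - 1) := fun j => Real.sq_sqrt (hwpos' j).le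
  have hAinv : ∀ z, scaleCLM (fun j => (w j)⁻¹) (scaleCLM w z) = z := fun z => by
    ext j
    rw [scaleCLM_apply, scaleCLM_apply, inv_mul_cancel_left₀ (hwpos j).ne']
  have hAinv' : ∀ z, scaleCLM w (scaleCLM (fun j => (w j)⁻¹) z) = z := fun z => by
    ext j
    rw [scaleCLM_apply, scaleCLM_apply, mul_inv_cancel_left₀ (hwpos j).ne']
  set V : E →L[ℝ] EuclideanSpace ℝ ι := scaleCLM w ∘L W with hV
  have hVinj : Function.Injective V := fun a b hab => hinj (by
    have := congrArg (scaleCLM fun j => (w j)⁻¹) hab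
    simpa [hV, hAinv] using this)
  obtain ⟨K, hK, hanti⟩ := V.exists_antilipschitzWith (LinearMap.ker_eq_bot.2 hVinj)
  set f : E → EuclideanSpace ℝ ι := fun θ => scaleCLM w (WithLp.toLp 2 (π θ - π θ₀)) with hf
  have hfd : HasFDerivAt f V θ₀ := by
    have h1 : HasFDerivAt (fun θ => (WithLp.toLp 2 (π θ) : EuclideanSpace ℝ ι)
        - WithLp.toLp 2 (π θ₀)) W θ₀ := hW.sub_const _
    exact (scaleCLM w).hasFDerivAt.comp θ₀ h1
  set M : Set ((ι → ℝ) × E) := {x | ∑ j, x.1 j = 1 ∧ x.2 ∈ Θ ∧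
    IsMinOn (fun θ' => dpd β x.1 (π θ')) Θ x.2} with hM
  -- The filter runs over all pairs (p, minimizer for p) with p tending to π(θ₀), so the little-o
  -- estimate is uniform over minimizers and needs no selection.
  set l : Filter ((ι → ℝ) × E) := comap Prod.fst (𝓝 (π θ₀)) ⊓ 𝓟 M with hl
  have hfst : Tendsto (Prod.fst : (ι → ℝ) × E → ι → ℝ) l (𝓝 (π θ₀)) :=
    tendsto_comap.mono_left inf_le_left
  have hmem : ∀ᶠ x in l, x ∈ M := mem_inf_of_right (mem_principal_self M)
  set y : (ι → ℝ) × E → EuclideanSpace ℝ ι := fun x => scaleCLM w (WithLp.toLp 2 (x.1 - π θ₀))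
    with hy
  have hcontL : Continuous fun p : ι → ℝ => scaleCLM w (WithLp.toLp 2 (p - π θ₀)) := by fun_prop
  have hylim : Tendsto y l (𝓝 0) := by
    have := (hcontL.tendsto (π θ₀)).comp hfst
    simpa [hy, Function.comp_def] using this
  have hsnd : Tendsto (Prod.snd : (ι → ℝ) × E → E) l (𝓝 θ₀) := by
    rw [Metric.tendsto_nhds]
    intro ε' hε'
    filter_upwards [hfst.eventually (eventually_norm_sub_lt_of_dpd_le hβ hθ₀ hpos hsum hprop hε'),
      hmem] with x hx hxM
    rw [dist_eq_norm]
    exact hx hxM.1 x.2 hxM.2.1 (hxM.2.2 hθ₀)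
  have hπc : ContinuousAt π θ₀ := by
    have h2 : ContinuousAt (fun θ => WithLp.ofLp (WithLp.toLp 2 (π θ) : EuclideanSpace ℝ ι)) θ₀ :=
      (PiLp.continuous_ofLp 2 _).continuousAt.comp hW.continuousAt
    exact h2
  have key := isLittleO_argmin_sub (l := l) (y := y) (f := f) (V := V) (θ₀ := θ₀) hfd (by simp [hf])
    (C := K) (NNReal.coe_pos.2 hK) (fun h => by simpa using hanti.le_mul_dist h 0)
    (T ∘L scaleCLM fun j => (w j)⁻¹)
    (fun z h => by
      have := horth (scaleCLM (fun j => (w j)⁻¹) z) h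
      have e : inner ℝ (z - V ((T ∘L scaleCLM fun j => (w j)⁻¹) z)) (V h)
          = (β + 1) / 2 * ∑ j, π θ₀ j ^ (β - 1) * ((scaleCLM (fun j => (w j)⁻¹) z) j
            - W (T (scaleCLM (fun j => (w j)⁻¹) z)) j) * W h j := by
        conv_lhs => rw [← hAinv' z]
        rw [PiLp.inner_apply, Finset.mul_sum]
        refine Finset.sum_congr rfl fun j _ => ?_
        simp only [hV, ContinuousLinearMap.comp_apply, hAinv', PiLp.sub_apply,
          scaleCLM_apply, RCLike.inner_apply, conj_trivial]
        have hinv : w j * ((w j)⁻¹ * z j) = z j := mul_inv_cancel_left₀ (hwpos j).ne' _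
        linear_combination ((w j)⁻¹ * z j - W (T (scaleCLM (fun j => (w j)⁻¹) z)) j) * W h j
          * hwsq j - w j * W h j * hinv
      rw [e, this, mul_zero])
    (D := fun x θ' => dpd β x.1 (π θ')) (θ := Prod.snd) hylim hsnd ?_ ?_
  -- The estimate is relative to the scaled vector y; returning to p - π(θ₀) costs the norm of the
  -- scaling.
  · have hev := key.def (c := ε / (‖scaleCLM w‖ + 1)) (by positivity)
    rw [hl, eventually_inf_principal, eventually_comap] at hev
    filter_upwards [hev] with p hp hp1 θ hθ hmin
    have h1 := hp (p, θ) rfl ⟨hp1, hθ, hmin⟩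
    simp only [hy, ContinuousLinearMap.comp_apply, hAinv] at h1
    refine h1.trans ?_
    rw [div_mul_eq_mul_div, div_le_iff₀ (by positivity), mul_assoc]
    gcongr
    rw [mul_comm]
    refine ((scaleCLM w).le_opNorm _).trans ?_
    gcongr
    linarith
  · intro ε' hε'
    choose δ hδ hexp using fun j => exists_dpdTerm_expansion β (hr j)
      (mul_pos hε' (hwpos' j))
    refine ⟨Θ ∩ {θ | ∀ j, |π θ j - π θ₀ j| < δ j}, inter_mem hΘ ?_, ?_⟩
    · exact eventually_all.2 fun j =>
        (((continuous_apply j).continuousAt.comp hπc).tendsto).eventually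
          (Metric.ball_mem_nhds (π θ₀ j) (hδ j))
    · have e2 : ∀ᶠ p in 𝓝 (π θ₀), ∀ j, |p j - π θ₀ j| < δ j := eventually_all.2 fun j =>
        ((continuous_apply j).tendsto (π θ₀)).eventually (Metric.ball_mem_nhds _ (hδ j))
      filter_upwards [hmem, hfst.eventually e2] with x hxM hx θ' hθ'
      rw [dpd_eq_sum_dpdTerm β (hxM.1.trans (hsum θ' hθ'.1).symm)]
      have e4 : ‖y x - f θ'‖ ^ 2 = ∑ j, (β + 1) / 2 * π θ₀ j ^ (β - 1) * (π θ' j - x.1 j) ^ 2 := by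
        rw [EuclideanSpace.norm_sq_eq]
        refine Finset.sum_congr rfl fun j _ => ?_
        simp only [hy, hf, PiLp.sub_apply, scaleCLM_apply, Pi.sub_apply, Real.norm_eq_abs, sq_abs,
          ← hwsq]
        ring
      rw [e4, ← Finset.sum_sub_distrib, Finset.mul_sum]
      refine (Finset.abs_sum_le_sum_abs _ _).trans (Finset.sum_le_sum fun j _ => ?_)
      refine (hexp j (x.1 j) (π θ' j) (hx j) (hθ'.2 j)).trans (le_of_eq ?_)
      ring
  · have hlim : Tendsto (fun x => θ₀ + (T ∘L scaleCLM fun j => (w j)⁻¹) (y x)) l (𝓝 θ₀) := by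
      have : Tendsto (fun x => θ₀ + (T ∘L scaleCLM fun j => (w j)⁻¹) (y x)) l
          (𝓝 (θ₀ + (T ∘L scaleCLM fun j => (w j)⁻¹) 0)) :=
        tendsto_const_nhds.add (((T ∘L scaleCLM fun j => (w j)⁻¹).continuous.tendsto 0).comp hylim)
      simpa using this
    filter_upwards [hmem, hlim.eventually hΘ] with x hxM hx
    exact ⟨hxM.2.2 hθ₀, hxM.2.2 hx⟩

end Argmin

/-! ### The cumulative exposure model -/

variable {L m : ℕ} (S : Design L)

lemma sum_castSucc_sub_succ {L : ℕ} (f : Fin (L + 1) → ℝ) :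
    ∑ j : Fin L, (f j.castSucc - f j.succ) = f 0 - f (Fin.last L) := by
  induction L with
  | zero => simp
  | succ L ih =>
    rw [Fin.sum_univ_castSucc]
    have := ih fun j => f j.castSucc
    simp only [Fin.succ_castSucc, Fin.castSucc_zero] at this ⊢
    rw [this]
    simp

lemma baseCumHazard_zero (θ : Param m) : baseCumHazard θ 0 = 0 := by
  simp [baseCumHazard]

/-- In the closed orthant all γ_i may vanish. Positivity of the hazard at one point excludes this
and replaces membership in `paramSpace` in the monotonicity lemmas. -/
lemma exists_gam_pos {θ : Param m} (hθ : ∀ i, 0 ≤ θ i) {s : ℝ} (h : 0 < baseCumHazard θ s) :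
    ∃ i, 0 < gam θ i := by
  by_contra! hcon
  have : ∀ i, gam θ i = 0 := fun i => le_antisymm (hcon i) (hθ _)
  simp [baseCumHazard, this] at h

lemma baseCumHazard_mono {θ : Param m} (hθ : ∀ i, 0 ≤ θ i) {s t : ℝ} (hs : 0 ≤ s) (hst : s ≤ t) :
    baseCumHazard θ s ≤ baseCumHazard θ t := by
  unfold baseCumHazard
  refine Finset.sum_le_sum fun i _ => ?_
  have : 0 ≤ gam θ i := hθ _
  gcongr

lemma baseCumHazard_strictMono {θ : Param m} (hθ : ∀ i, 0 ≤ θ i) {r : ℝ}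
    (hr : 0 < baseCumHazard θ r) {s t : ℝ} (hs : 0 ≤ s) (hst : s < t) :
    baseCumHazard θ s < baseCumHazard θ t := by
  obtain ⟨i, hi⟩ := exists_gam_pos hθ hr
  unfold baseCumHazard
  refine Finset.sum_lt_sum (fun j _ => ?_) ⟨i, Finset.mem_univ i, ?_⟩
  · have : 0 ≤ gam θ j := hθ _
    gcongr
  · gcongr

lemma baseCumHazard_pos {θ : Param m} (hθ : ∀ i, 0 ≤ θ i) {r : ℝ}
    (hr : 0 < baseCumHazard θ r) {t : ℝ} (ht : 0 < t) : 0 < baseCumHazard θ t := by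
  have := baseCumHazard_strictMono hθ hr le_rfl ht
  rwa [baseCumHazard_zero] at this

lemma baseCumHazard_pos_of_mem {θ : Param m} (hθ : θ ∈ paramSpace m) {t : ℝ} (ht : 0 < t) :
    0 < baseCumHazard θ t := by
  unfold baseCumHazard
  refine Finset.sum_pos (fun i _ => ?_) Finset.univ_nonempty
  have : 0 < gam θ i := hθ _
  positivity

lemma contDiff_baseCumHazard :
    ContDiff ℝ 1 fun x : Param m × ℝ => baseCumHazard x.1 x.2 := by
  unfold baseCumHazard gam
  fun_prop

lemma continuous_baseCumHazard (θ : Param m) : Continuous (baseCumHazard θ) := by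
  unfold baseCumHazard
  fun_prop

lemma Design.τ_pos : 0 < S.τ := by
  rw [Design.τ, ← S.t_zero]
  exact S.t_strictMono S.k_pos

lemma Design.t_nonneg (j : Fin (L + 1)) : 0 ≤ S.t j := by
  rw [← S.t_zero]
  exact S.t_strictMono.monotone (Fin.zero_le j)

lemma Design.τ_lt_last : S.τ < S.t (Fin.last L) := S.t_strictMono S.k_lt

/-- `u` is the time which has to be spent at the higher stress level to accumulate the hazard
of the first stress phase. -/
def Design.IsEquivTime (θ : Param m) (u : ℝ) : Prop :=
  0 ≤ u ∧ u ≤ S.τ ∧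
    Real.exp (slope θ * S.x₂) * baseCumHazard θ u = Real.exp (slope θ * S.x₁) * baseCumHazard θ S.τ

lemma exp_mul_eq_iff {a x₁ x₂ p q : ℝ} :
    Real.exp (a * x₂) * p = Real.exp (a * x₁) * q ↔ p = Real.exp (a * (x₁ - x₂)) * q := by
  have h : Real.exp (a * x₁) = Real.exp (a * x₂) * Real.exp (a * (x₁ - x₂)) := by
    rw [← Real.exp_add]; congr 1; ring
  rw [h, mul_assoc]
  exact mul_right_inj' (Real.exp_pos _).ne'

/-- Since a₁(x₁ - x₂) ≤ 0, the required hazard lies between H₀(0) and H₀(τ), and the intermediate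
value theorem applies. -/
lemma Design.exists_isEquivTime {θ : Param m} (hθ : ∀ i, 0 ≤ θ i) :
    ∃ u, S.IsEquivTime θ u := by
  have hτ := S.τ_pos
  have h0 : 0 ≤ baseCumHazard θ S.τ := by
    rw [← baseCumHazard_zero θ]
    exact baseCumHazard_mono hθ le_rfl hτ.le
  have hexp : Real.exp (slope θ * (S.x₁ - S.x₂)) ≤ 1 := by
    rw [Real.exp_le_one_iff]
    exact mul_nonpos_of_nonneg_of_nonpos (hθ _) (by linarith [S.stress_lt])
  obtain ⟨u, hu, hu'⟩ := intermediate_value_Icc hτ.le (continuous_baseCumHazard θ).continuousOn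
    (show Real.exp (slope θ * (S.x₁ - S.x₂)) * baseCumHazard θ S.τ ∈ Set.Icc _ _ from
      ⟨by rw [baseCumHazard_zero]; positivity, mul_le_of_le_one_left h0 hexp⟩)
  exact ⟨u, hu.1, hu.2, exp_mul_eq_iff.2 hu'⟩

/-- Strict monotonicity of H₀ on [0, ∞) excludes solutions beyond u. Solutions with negative τ + s
may exist but are smaller, so the supremum is attained at u - τ. -/
lemma Design.IsEquivTime.shift_eq {θ : Param m} {u : ℝ} (h : S.IsEquivTime θ u)
    (hθ : ∀ i, 0 ≤ θ i) (hpos : 0 < baseCumHazard θ S.τ) : S.shift θ = u - S.τ := by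
  have h3 := exp_mul_eq_iff.1 h.2.2
  refine IsGreatest.csSup_eq ⟨⟨by linarith [h.2.1], ?_⟩, fun s hs => ?_⟩
  · rw [add_sub_cancel]; exact h3
  · by_contra hcon
    have h1 : u < S.τ + s := by linarith
    have h2 := baseCumHazard_strictMono hθ hpos h.1 h1
    rw [hs.2, h3] at h2
    exact lt_irrefl _ h2

lemma Design.IsEquivTime.pos {θ : Param m} {u : ℝ} (h : S.IsEquivTime θ u)
    (hpos : 0 < baseCumHazard θ S.τ) : 0 < u := by
  refine lt_of_le_of_ne h.1 fun h0 => ?_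
  have h3 := h.2.2
  rw [← h0, baseCumHazard_zero, mul_zero] at h3
  have : 0 < Real.exp (slope θ * S.x₁) * baseCumHazard θ S.τ := by positivity
  linarith

lemma Design.IsEquivTime.lt_τ {θ : Param m} {u : ℝ} (h : S.IsEquivTime θ u)
    (hθ : θ ∈ paramSpace m) : u < S.τ := by
  refine lt_of_le_of_ne h.2.1 fun h0 => ?_
  have h3 := exp_mul_eq_iff.1 h.2.2
  rw [h0] at h3
  have hpos := baseCumHazard_pos_of_mem hθ S.τ_pos
  have h4 : Real.exp (slope θ * (S.x₁ - S.x₂)) < 1 := by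
    rw [Real.exp_lt_one_iff]
    exact mul_neg_of_pos_of_neg (hθ _) (by linarith [S.stress_lt])
  nlinarith

lemma Design.cumHazard_of_le {θ : Param m} {u : ℝ} (h : S.IsEquivTime θ u)
    (hθ : ∀ i, 0 ≤ θ i) (hpos : 0 < baseCumHazard θ S.τ) {t : ℝ} (ht : t ≤ S.τ) :
    S.cumHazard θ t = Real.exp (slope θ * S.x₁) * baseCumHazard θ t := by
  rcases ht.lt_or_eq with ht | ht
  · rw [Design.cumHazard, if_pos ht]
  · rw [Design.cumHazard, if_neg (not_lt.2 ht.ge), h.shift_eq S hθ hpos, ht, add_sub_cancel,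
      h.2.2]

lemma Design.cumHazard_of_ge {θ : Param m} {u : ℝ} (h : S.IsEquivTime θ u)
    (hθ : ∀ i, 0 ≤ θ i) (hpos : 0 < baseCumHazard θ S.τ) {t : ℝ} (ht : S.τ ≤ t) :
    S.cumHazard θ t = Real.exp (slope θ * S.x₂) * baseCumHazard θ (t - S.τ + u) := by
  rw [Design.cumHazard, if_neg (not_lt.2 ht), h.shift_eq S hθ hpos]
  congr 2
  ring

lemma Design.cumHazard_zero (θ : Param m) : S.cumHazard θ 0 = 0 := by
  rw [Design.cumHazard, if_pos S.τ_pos, baseCumHazard_zero, mul_zero]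

lemma Design.cumHazard_strictMono {θ : Param m} (hθ : θ ∈ paramSpace m) {s t : ℝ} (hs : 0 ≤ s)
    (hst : s < t) : S.cumHazard θ s < S.cumHazard θ t := by
  have hθ' : ∀ i, 0 ≤ θ i := fun i => (hθ i).le
  have hpos := baseCumHazard_pos_of_mem hθ S.τ_pos
  obtain ⟨u, hu⟩ := S.exists_isEquivTime hθ'
  have h1 : ∀ {s t : ℝ}, 0 ≤ s → s < t → t ≤ S.τ → S.cumHazard θ s < S.cumHazard θ t := by
    intro s t hs hst ht
    rw [S.cumHazard_of_le hu hθ' hpos ht, S.cumHazard_of_le hu hθ' hpos (hst.le.trans ht)]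
    exact mul_lt_mul_of_pos_left (baseCumHazard_strictMono hθ' hpos hs hst) (Real.exp_pos _)
  have h2 : ∀ {s t : ℝ}, S.τ ≤ s → s < t → S.cumHazard θ s < S.cumHazard θ t := by
    intro s t hs hst
    rw [S.cumHazard_of_ge hu hθ' hpos hs, S.cumHazard_of_ge hu hθ' hpos (hs.trans hst.le)]
    exact mul_lt_mul_of_pos_left (baseCumHazard_strictMono hθ' hpos (by linarith [hu.1])
      (by linarith)) (Real.exp_pos _)
  rcases le_or_gt t S.τ with ht | ht
  · exact h1 hs hst ht
  · rcases le_or_gt S.τ s with hs' | hs'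
    · exact h2 hs' hst
    · exact (h1 hs hs' le_rfl).trans (h2 le_rfl ht)

lemma Design.cellProb_castSucc (θ : Param m) (j : Fin L) : S.cellProb θ j.castSucc
    = S.reliability θ (S.t j.castSucc) - S.reliability θ (S.t j.succ) := by
  simp [Design.cellProb]

lemma Design.cellProb_last (θ : Param m) :
    S.cellProb θ (Fin.last L) = S.reliability θ (S.t (Fin.last L)) := by
  simp [Design.cellProb]

lemma Design.reliability_t_zero (θ : Param m) : S.reliability θ (S.t 0) = 1 := by
  rw [Design.reliability, S.t_zero, S.cumHazard_zero, neg_zero, Real.exp_zero]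

lemma Design.sum_cellProb (θ : Param m) : ∑ j, S.cellProb θ j = 1 := by
  rw [Fin.sum_univ_castSucc, S.cellProb_last]
  simp only [S.cellProb_castSucc]
  rw [sum_castSucc_sub_succ fun j => S.reliability θ (S.t j), S.reliability_t_zero]
  ring

lemma Design.cellProb_pos {θ : Param m} (hθ : θ ∈ paramSpace m) (j : Fin (L + 1)) :
    0 < S.cellProb θ j := by
  refine Fin.lastCases ?_ (fun j => ?_) j
  · rw [S.cellProb_last]
    exact Real.exp_pos _
  · rw [S.cellProb_castSucc, sub_pos]
    refine Real.exp_lt_exp.2 (neg_lt_neg ?_)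
    exact S.cumHazard_strictMono hθ (S.t_nonneg _) (S.t_strictMono (Fin.castSucc_lt_succ))

lemma Design.reliability_t (θ : Param m) (j : Fin (L + 1)) :
    S.reliability θ (S.t j) = 1 - ∑ i ∈ Finset.Iio j, S.cellProb θ i := by
  induction j using Fin.induction with
  | zero =>
    have : Finset.Iio (0 : Fin (L + 1)) = ∅ := by
      ext i; simp
    rw [this, S.reliability_t_zero, Finset.sum_empty, sub_zero]
  | succ j ih =>
    have : Finset.Iio j.succ = insert j.castSucc (Finset.Iio j.castSucc) := by
      ext i
      simp only [Finset.mem_Iio, Finset.mem_insert, Fin.lt_def, Fin.ext_iff, Fin.val_succ,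
        Fin.val_castSucc]
      omega
    rw [this, Finset.sum_insert (by simp), S.cellProb_castSucc, ih]
    ring

/-- Partial sums of cell probabilities recover the reliabilities, so convergence, equality and
vanishing derivatives pass from π to the hazards at inspection times. -/
lemma Design.cumHazard_t (θ : Param m) (j : Fin (L + 1)) :
    S.cumHazard θ (S.t j) = -Real.log (1 - ∑ i ∈ Finset.Iio j, S.cellProb θ i) := by
  rw [← S.reliability_t, Design.reliability, Real.log_exp, neg_neg]

/-! ### Differentiability -/

lemma isOpen_paramSpace : IsOpen (paramSpace m) := by
  have : paramSpace m = ⋂ i, {θ : Param m | 0 < θ i} := by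
    ext θ; simp [paramSpace]
  rw [this]
  exact isOpen_iInter_of_finite fun i => isOpen_lt continuous_const (by fun_prop)

/-- The baseline hazard. -/
def baseHazard (θ : Param m) (t : ℝ) : ℝ := ∑ i : Fin (m + 1), gam θ i * t ^ (i : ℕ)

lemma hasDerivAt_baseCumHazard (θ : Param m) (t : ℝ) :
    HasDerivAt (baseCumHazard θ) (baseHazard θ t) t := by
  unfold baseHazard
  have : baseCumHazard θ = fun t =>
      ∑ i : Fin (m + 1), gam θ i * t ^ ((i : ℕ) + 1) / ((i : ℕ) + 1) := rfl
  rw [this]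
  refine HasDerivAt.fun_sum fun i _ => ?_
  have h := ((hasDerivAt_pow ((i : ℕ) + 1) t).const_mul (gam θ i)).div_const (((i : ℕ) : ℝ) + 1)
  have hne : (((i : ℕ) : ℝ) + 1) ≠ 0 := by positivity
  have e : gam θ i * t ^ (i : ℕ)
      = gam θ i * (((i : ℕ) + 1 : ℕ) * t ^ ((i : ℕ) + 1 - 1)) / (((i : ℕ) : ℝ) + 1) := by
    push_cast
    field_simp
  rw [e]
  exact h

lemma baseHazard_pos {θ : Param m} (hθ : θ ∈ paramSpace m) {t : ℝ} (ht : 0 ≤ t) :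
    0 < baseHazard θ t := by
  unfold baseHazard
  rw [Fin.sum_univ_succ]
  have h0 : 0 < gam θ 0 := hθ _
  have : 0 ≤ ∑ i : Fin m, gam θ i.succ * t ^ ((i.succ : Fin (m + 1)) : ℕ) :=
    Finset.sum_nonneg fun i _ => mul_nonneg (hθ _).le (pow_nonneg ht _)
  simp only [Fin.val_zero, pow_zero, mul_one]
  linarith

/-- The implicit function theorem applies to the equation for the equivalent time u, because its
time derivative there is h₀(u) > 0. -/
lemma Design.differentiableAt_shift {θ₁ : Param m} (hθ₁ : θ₁ ∈ paramSpace m) :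
    DifferentiableAt ℝ (fun θ : Param m => S.shift θ) θ₁ := by
  obtain ⟨u, hu⟩ := S.exists_isEquivTime fun i => (hθ₁ i).le
  have hu0 := hu.pos S (baseCumHazard_pos_of_mem hθ₁ S.τ_pos)
  have huτ := hu.lt_τ S hθ₁
  set f : Param m × ℝ → ℝ := fun x => baseCumHazard x.1 x.2
    - Real.exp (slope x.1 * (S.x₁ - S.x₂)) * baseCumHazard x.1 S.τ with hf
  have hfc : ContDiff ℝ 1 f := by
    refine contDiff_baseCumHazard.sub (ContDiff.mul ?_ ?_)
    · unfold slope
      fun_prop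
    · exact contDiff_baseCumHazard.comp (contDiff_fst.prodMk contDiff_const)
  have hstrict := (hfc.contDiffAt (x := (θ₁, u))).hasStrictFDerivAt one_ne_zero
  have hpartial : fderiv ℝ f (θ₁, u) (0, 1) = baseHazard θ₁ u := by
    have h1 : HasDerivAt (fun s : ℝ => ((θ₁, s) : Param m × ℝ)) (0, 1) u :=
      (hasDerivAt_const u θ₁).prodMk (hasDerivAt_id u)
    have h2 : HasDerivAt (fun s : ℝ => f (θ₁, s)) (fderiv ℝ f (θ₁, u) (0, 1)) u :=
      hstrict.hasFDerivAt.comp_hasDerivAt u h1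
    exact h2.unique ((hasDerivAt_baseCumHazard θ₁ u).sub_const
      (Real.exp (slope θ₁ * (S.x₁ - S.x₂)) * baseCumHazard θ₁ S.τ))
  have hne : baseHazard θ₁ u ≠ 0 := (baseHazard_pos hθ₁ hu0.le).ne'
  have hinv : (fderiv ℝ f (θ₁, u) ∘L .inr ℝ (Param m) ℝ).IsInvertible := by
    refine ContinuousLinearMap.IsInvertible.of_inverse
      (g := (baseHazard θ₁ u)⁻¹ • ContinuousLinearMap.id ℝ ℝ) ?_ ?_ <;>
    · ext
      simp [hpartial, hne]
  set ψ := hstrict.implicitFunctionOfProdDomain hinv with hψ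
  have hd : DifferentiableAt ℝ ψ θ₁ :=
    (hstrict.hasStrictFDerivAt_implicitFunctionOfProdDomain hinv).hasFDerivAt.differentiableAt
  have hlim : Tendsto ψ (𝓝 θ₁) (𝓝 u) := hstrict.tendsto_implicitFunctionOfProdDomain hinv
  have hzero : f (θ₁, u) = 0 := sub_eq_zero.2 (exp_mul_eq_iff.1 hu.2.2)
  -- Since 0 < u < τ strictly, nearby implicit solutions remain in (0, τ), hence are equivalent
  -- times and give the shift.
  have heq : (fun θ : Param m => S.shift θ) =ᶠ[𝓝 θ₁] fun θ => ψ θ - S.τ := by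
    filter_upwards [hstrict.eventually_apply_implicitFunctionOfProdDomain hinv,
      hlim.eventually (lt_mem_nhds hu0), hlim.eventually (gt_mem_nhds huτ),
      isOpen_paramSpace.mem_nhds hθ₁] with θ h1 h2 h3 h4
    rw [hzero] at h1
    have h5 : S.IsEquivTime θ (ψ θ) := ⟨h2.le, h3.le, exp_mul_eq_iff.2 (sub_eq_zero.1 h1)⟩
    exact h5.shift_eq S (fun i => (h4 i).le) (baseCumHazard_pos_of_mem h4 S.τ_pos)
  exact (hd.sub_const _).congr_of_eventuallyEq heq

lemma differentiableAt_slope (θ₁ : Param m) :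
    DifferentiableAt ℝ (fun θ : Param m => slope θ) θ₁ := by
  unfold slope
  fun_prop

lemma Design.differentiableAt_cumHazard {θ₁ : Param m} (hθ₁ : θ₁ ∈ paramSpace m) (t : ℝ) :
    DifferentiableAt ℝ (fun θ : Param m => S.cumHazard θ t) θ₁ := by
  have hs := differentiableAt_slope θ₁
  have hB : ∀ g : Param m → ℝ, DifferentiableAt ℝ g θ₁ →
      DifferentiableAt ℝ (fun θ : Param m => baseCumHazard θ (g θ)) θ₁ := fun g hg =>
    DifferentiableAt.comp (g := fun x : Param m × ℝ => baseCumHazard x.1 x.2) θ₁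
      (contDiff_baseCumHazard.differentiable one_ne_zero _) (differentiableAt_id.prodMk hg)
  unfold Design.cumHazard
  split_ifs with h
  · exact ((hs.mul_const _).exp).mul (hB _ (differentiableAt_const t))
  · exact ((hs.mul_const _).exp).mul (hB _ ((S.differentiableAt_shift hθ₁).const_add t))

lemma Design.differentiableAt_cellProb {θ₁ : Param m} (hθ₁ : θ₁ ∈ paramSpace m) :
    DifferentiableAt ℝ (fun θ : Param m => S.cellProb θ) θ₁ := by
  rw [differentiableAt_pi]
  have hR : ∀ t, DifferentiableAt ℝ (fun θ : Param m => S.reliability θ t) θ₁ := fun t =>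
    (S.differentiableAt_cumHazard hθ₁ t).neg.exp
  intro j
  refine Fin.lastCases ?_ (fun j => ?_) j
  · simp only [S.cellProb_last]
    exact hR _
  · simp only [S.cellProb_castSucc]
    exact (hR _).sub (hR _)

/-! ### The cell probabilities determine the parameter continuously -/

lemma Design.cellProb_eq_of_cumHazard_eq {θ θ' : Param m}
    (h : ∀ j, S.cumHazard θ (S.t j) = S.cumHazard θ' (S.t j)) : S.cellProb θ = S.cellProb θ' := by
  funext j
  refine Fin.lastCases ?_ (fun j => ?_) j
  · simp only [S.cellProb_last, Design.reliability, h]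
  · simp only [S.cellProb_castSucc, Design.reliability, h]

lemma Design.cumHazard_eq_of_cellProb_eq {θ θ' : Param m}
    (h : S.cellProb θ = S.cellProb θ') (j : Fin (L + 1)) :
    S.cumHazard θ (S.t j) = S.cumHazard θ' (S.t j) := by
  rw [S.cumHazard_t, S.cumHazard_t, h]

/-- All exponents lie between 1 and m + 1 and c ≤ 1. The factor does not depend on θ, so hazards at
different times are comparable uniformly over the parameters. -/
lemma baseCumHazard_scale_le {θ : Param m} (hθ : ∀ i, 0 ≤ θ i) {c t : ℝ} (hc : 0 ≤ c)
    (hc1 : c ≤ 1) (ht : 0 ≤ t) : c ^ (m + 1) * baseCumHazard θ t ≤ baseCumHazard θ (c * t) := by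
  unfold baseCumHazard
  rw [Finset.mul_sum]
  refine Finset.sum_le_sum fun i _ => ?_
  have h0 : 0 ≤ gam θ i := hθ _
  have h1 : c ^ (m + 1) ≤ c ^ ((i : ℕ) + 1) := pow_le_pow_of_le_one hc hc1 (by omega)
  rw [mul_pow]
  calc c ^ (m + 1) * (gam θ i * t ^ ((i : ℕ) + 1) / ((i : ℕ) + 1))
      ≤ c ^ ((i : ℕ) + 1) * (gam θ i * t ^ ((i : ℕ) + 1) / ((i : ℕ) + 1)) := by gcongr
    _ = _ := by ring

/-- Parameters whose cumulative hazards at `τ` and at the termination time stay in a compact part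
of `(0, ∞)` are bounded. -/
lemma Design.exists_bound {A M : ℝ} (hA : 0 < A) (hM : 0 < M) :
    ∃ R : Fin (m + 2) → ℝ, ∀ θ ∈ paramSpace m, A ≤ S.cumHazard θ S.τ → S.cumHazard θ S.τ ≤ M →
      S.cumHazard θ (S.t (Fin.last L)) ≤ M → ∀ i, θ i ≤ R i := by
  have hτ := S.τ_pos
  set d := S.t (Fin.last L) - S.τ with hd
  have hd0 : 0 < d := sub_pos.2 S.τ_lt_last
  -- As cτ ≤ d, the hazard at t_L is at least exp(a₁x₂) c^(m+1) H₀(τ), while exp(a₁x₁) H₀(τ) ≥ A.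
  -- Together these give exp(a₁(x₂ - x₁)) ≤ Q.
  set c := min 1 (d / S.τ) with hc
  have hc0 : 0 < c := by positivity
  set Q := M / (c ^ (m + 1) * A) with hQ
  have hQ0 : 0 < Q := by positivity
  have hx : 0 < S.x₂ - S.x₁ := sub_pos.2 S.stress_lt
  set amax := Real.log Q / (S.x₂ - S.x₁) with hamax
  refine ⟨Fin.snoc (α := fun _ => ℝ) (fun i : Fin (m + 1) =>
    M * Real.exp (amax * |S.x₁|) / (S.τ ^ ((i : ℕ) + 1) / ((i : ℕ) + 1))) amax, ?_⟩
  intro θ hθ h1 h2 h3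
  have hθ' : ∀ i, 0 ≤ θ i := fun i => (hθ i).le
  have hpos := baseCumHazard_pos_of_mem hθ hτ
  obtain ⟨u, hu⟩ := S.exists_isEquivTime hθ'
  rw [S.cumHazard_of_le hu hθ' hpos le_rfl] at h1 h2
  rw [S.cumHazard_of_ge hu hθ' hpos S.τ_lt_last.le, ← hd] at h3
  have hcτ : c * S.τ ≤ d := by
    have : c ≤ d / S.τ := min_le_right _ _
    rwa [le_div_iff₀ hτ] at this
  have h4 : c ^ (m + 1) * baseCumHazard θ S.τ ≤ baseCumHazard θ (d + u) :=
    (baseCumHazard_scale_le hθ' hc0.le (min_le_left _ _) hτ.le).trans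
      (baseCumHazard_mono hθ' (by positivity) (by linarith [hu.1]))
  have hexp : Real.exp (slope θ * S.x₂)
      = Real.exp (slope θ * (S.x₂ - S.x₁)) * Real.exp (slope θ * S.x₁) := by
    rw [← Real.exp_add]; congr 1; ring
  have hs : slope θ ≤ amax := by
    rw [hamax, le_div_iff₀ hx, Real.le_log_iff_exp_le hQ0, hQ, le_div_iff₀ (by positivity)]
    calc Real.exp (slope θ * (S.x₂ - S.x₁)) * (c ^ (m + 1) * A)
        ≤ Real.exp (slope θ * (S.x₂ - S.x₁)) * (c ^ (m + 1) *
            (Real.exp (slope θ * S.x₁) * baseCumHazard θ S.τ)) := by gcongr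
      _ = Real.exp (slope θ * S.x₂) * (c ^ (m + 1) * baseCumHazard θ S.τ) := by rw [hexp]; ring
      _ ≤ Real.exp (slope θ * S.x₂) * baseCumHazard θ (d + u) := by gcongr
      _ ≤ M := h3
  intro i
  refine Fin.lastCases ?_ (fun i => ?_) i
  · rw [Fin.snoc_last]
    exact hs
  · rw [Fin.snoc_castSucc, le_div_iff₀ (by positivity)]
    have h5 : gam θ i * (S.τ ^ ((i : ℕ) + 1) / ((i : ℕ) + 1)) ≤ baseCumHazard θ S.τ := by
      rw [← mul_div_assoc]
      refine Finset.single_le_sum (f := fun i : Fin (m + 1) =>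
        gam θ i * S.τ ^ ((i : ℕ) + 1) / ((i : ℕ) + 1)) (fun j _ => ?_) (Finset.mem_univ i)
      have : 0 ≤ gam θ j := hθ' _
      positivity
    refine h5.trans ?_
    -- The bound on a₁ now turns the bound on the hazard at τ into one on H₀(τ); the sign of x₁ is
    -- arbitrary, hence |x₁|.
    have h6 : baseCumHazard θ S.τ
        = (Real.exp (slope θ * S.x₁) * baseCumHazard θ S.τ) * Real.exp (-(slope θ * S.x₁)) := by
      rw [Real.exp_neg]
      field_simp
    rw [h6]
    have h7 : -(slope θ * S.x₁) ≤ amax * |S.x₁| := by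
      have h8 : slope θ * -S.x₁ ≤ slope θ * |S.x₁| :=
        mul_le_mul_of_nonneg_left (neg_le_abs _) (hθ' _)
      have h9 : slope θ * |S.x₁| ≤ amax * |S.x₁| := by gcongr
      linarith
    gcongr

lemma isCompact_orthant_box (R : Fin (m + 2) → ℝ) :
    IsCompact {θ : Param m | ∀ i, 0 ≤ θ i ∧ θ i ≤ R i} := by
  have h : IsCompact (Set.univ.pi fun i => Set.Icc 0 (R i)) :=
    isCompact_univ_pi fun i => isCompact_Icc
  have h2 := h.image (PiLp.continuous_toLp 2 fun _ : Fin (m + 2) => ℝ)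
  refine h2.of_isClosed_subset ?_ ?_
  · have : {θ : Param m | ∀ i, 0 ≤ θ i ∧ θ i ≤ R i}
        = ⋂ i, ({θ : Param m | 0 ≤ θ i} ∩ {θ : Param m | θ i ≤ R i}) := by
      ext θ; simp
    rw [this]
    exact isClosed_iInter fun i => (isClosed_le continuous_const (by fun_prop)).inter
      (isClosed_le (by fun_prop) continuous_const)
  · intro θ hθ
    exact ⟨θ.ofLp, fun i _ => hθ i, rfl⟩

lemma continuous_baseCumHazard_prod :
    Continuous fun x : Param m × ℝ => baseCumHazard x.1 x.2 := contDiff_baseCumHazard.continuous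

lemma continuous_slope : Continuous fun θ : Param m => slope θ := by
  unfold slope
  fun_prop

/-- At an identified parameter, parameters with nearby cell probabilities are nearby. -/
theorem Design.IdentifiableAt.exists_forall_norm_sub_lt {θ₀ : Param m} (h : S.IdentifiableAt θ₀)
    (hθ₀ : θ₀ ∈ paramSpace m) {ε : ℝ} (hε : 0 < ε) :
    ∃ η > 0, ∀ θ ∈ paramSpace m, (∀ j, |S.cellProb θ j - S.cellProb θ₀ j| < η) →
      ‖θ - θ₀‖ < ε := by
  by_contra! hcon
  choose x hxΘ hxπ hxε using fun n : ℕ => hcon (1 / ((n : ℝ) + 1)) (by positivity)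
  have hπ : ∀ j, Tendsto (fun n => S.cellProb (x n) j) atTop (𝓝 (S.cellProb θ₀ j)) := by
    intro j
    rw [tendsto_iff_dist_tendsto_zero]
    refine squeeze_zero (fun _ => dist_nonneg) (fun n => ?_)
      (tendsto_one_div_add_atTop_nhds_zero_nat (𝕜 := ℝ))
    rw [Real.dist_eq]
    exact (hxπ n j).le
  have hH : ∀ j, Tendsto (fun n => S.cumHazard (x n) (S.t j)) atTop
      (𝓝 (S.cumHazard θ₀ (S.t j))) := by
    intro j
    simp only [S.cumHazard_t]
    refine (Tendsto.log ((tendsto_finsetSum _ fun i _ => hπ i).const_sub 1) ?_).neg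
    rw [← S.reliability_t]
    exact (Real.exp_pos _).ne'
  have hCk : 0 < S.cumHazard θ₀ S.τ := by
    have := S.cumHazard_strictMono hθ₀ le_rfl S.τ_pos
    rwa [S.cumHazard_zero] at this
  have hHk : Tendsto (fun n => S.cumHazard (x n) S.τ) atTop (𝓝 (S.cumHazard θ₀ S.τ)) := hH S.k
  set M := max (S.cumHazard θ₀ S.τ) (S.cumHazard θ₀ (S.t (Fin.last L))) + 1 with hM
  have hM0 : 0 < M := by
    have := le_max_left (S.cumHazard θ₀ S.τ) (S.cumHazard θ₀ (S.t (Fin.last L)))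
    linarith
  obtain ⟨R, hR⟩ := S.exists_bound (m := m) (half_pos hCk) hM0
  -- The equivalent times are carried along as an extra coordinate in the compact interval [0, τ].
  -- Their defining equation passes to the limit, so continuity of `shift` up to the boundary is not
  -- needed.
  choose u hu using fun n => S.exists_isEquivTime fun i => (hxΘ n i).le
  have hev : ∀ᶠ n in atTop, (x n, u n) ∈
      {θ : Param m | ∀ i, 0 ≤ θ i ∧ θ i ≤ R i} ×ˢ Set.Icc 0 S.τ := by
    filter_upwards [hHk.eventually (lt_mem_nhds (half_lt_self hCk)),
      hHk.eventually (gt_mem_nhds (lt_of_le_of_lt (le_max_left _ _) (lt_add_one _))),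
      (hH (Fin.last L)).eventually (gt_mem_nhds (lt_of_le_of_lt (le_max_right _ _) (lt_add_one _)))]
      with n h1 h2 h3
    exact ⟨fun i => ⟨(hxΘ n i).le, hR (x n) (hxΘ n) h1.le h2.le h3.le i⟩, (hu n).1, (hu n).2.1⟩
  obtain ⟨⟨θ, v⟩, hmem, φ, hφ, hlim⟩ :=
    ((isCompact_orthant_box R).prod isCompact_Icc).tendsto_subseq' hev.frequently
  have hlimθ : Tendsto (fun n => x (φ n)) atTop (𝓝 θ) := (continuous_fst.tendsto _).comp hlim
  have hθ0 : ∀ i, 0 ≤ θ i := fun i => (hmem.1 i).1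
  have hfirst : ∀ (w : ℝ) (t : ℝ), Tendsto (fun n => Real.exp (slope (x (φ n)) * w)
      * baseCumHazard (x (φ n)) t) atTop (𝓝 (Real.exp (slope θ * w) * baseCumHazard θ t)) := by
    intro w t
    have : Continuous fun θ : Param m => Real.exp (slope θ * w) * baseCumHazard θ t :=
      (Real.continuous_exp.comp (continuous_slope.mul continuous_const)).mul
        (continuous_baseCumHazard_prod.comp (continuous_id.prodMk continuous_const))
    exact (this.tendsto θ).comp hlimθ
  have hsecond : ∀ (w : ℝ) (t : ℝ), Tendsto (fun n => Real.exp (slope (x (φ n)) * w)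
      * baseCumHazard (x (φ n)) (t + u (φ n))) atTop
      (𝓝 (Real.exp (slope θ * w) * baseCumHazard θ (t + v))) := by
    intro w t
    have : Continuous fun y : Param m × ℝ => Real.exp (slope y.1 * w)
        * baseCumHazard y.1 (t + y.2) :=
      (Real.continuous_exp.comp ((continuous_slope.comp continuous_fst).mul continuous_const)).mul
        (continuous_baseCumHazard_prod.comp
          (continuous_fst.prodMk (continuous_const.add continuous_snd)))
    exact (this.tendsto (θ, v)).comp hlim
  have hequiv : S.IsEquivTime θ v := by
    refine ⟨hmem.2.1, hmem.2.2, ?_⟩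
    have h1 := hsecond S.x₂ 0
    simp only [zero_add] at h1
    exact tendsto_nhds_unique (h1.congr fun n => (hu (φ n)).2.2) (hfirst S.x₁ S.τ)
  have hposn : ∀ n, 0 < baseCumHazard (x n) S.τ := fun n => baseCumHazard_pos_of_mem (hxΘ n) S.τ_pos
  have hτlim : Real.exp (slope θ * S.x₁) * baseCumHazard θ S.τ = S.cumHazard θ₀ S.τ := by
    refine tendsto_nhds_unique (hfirst S.x₁ S.τ) ((hHk.comp hφ.tendsto_atTop).congr fun n => ?_)
    exact S.cumHazard_of_le (hu (φ n)) (fun i => (hxΘ _ i).le) (hposn _) le_rfl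
  -- The limit may lie on the boundary, but its hazard at τ is still positive; this makes v the
  -- equivalent time behind its `shift`.
  have hposθ : 0 < baseCumHazard θ S.τ := by
    rw [← hτlim] at hCk
    exact pos_of_mul_pos_right hCk (Real.exp_pos _).le
  have heq : ∀ j, S.cumHazard θ (S.t j) = S.cumHazard θ₀ (S.t j) := by
    intro j
    refine tendsto_nhds_unique ?_ ((hH j).comp hφ.tendsto_atTop)
    rcases le_total (S.t j) S.τ with hj | hj
    · rw [S.cumHazard_of_le hequiv hθ0 hposθ hj]
      refine (hfirst S.x₁ (S.t j)).congr fun n => ?_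
      exact (S.cumHazard_of_le (hu (φ n)) (fun i => (hxΘ _ i).le) (hposn _) hj).symm
    · rw [S.cumHazard_of_ge hequiv hθ0 hposθ hj]
      refine (hsecond S.x₂ (S.t j - S.τ)).congr fun n => ?_
      exact (S.cumHazard_of_ge (hu (φ n)) (fun i => (hxΘ _ i).le) (hposn _) hj).symm
  have hθeq := h θ hθ0 (S.cellProb_eq_of_cumHazard_eq heq)
  rw [hθeq] at hlimθ
  have h1 : Tendsto (fun n => ‖x (φ n) - θ₀‖) atTop (𝓝 0) := by
    have := (hlimθ.sub_const θ₀).norm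
    simpa using this
  exact absurd (ge_of_tendsto' h1 fun n => hxε (φ n)) (not_le.2 hε)

/-! ### Identifiability -/

open Polynomial in
/-- The cumulative baseline hazard as a polynomial. -/
def hazardPoly (θ : Param m) : ℝ[X] :=
  ∑ i : Fin (m + 1), C (gam θ i / ((i : ℕ) + 1)) * X ^ ((i : ℕ) + 1)

lemma eval_hazardPoly (θ : Param m) (t : ℝ) : (hazardPoly θ).eval t = baseCumHazard θ t := by
  simp only [hazardPoly, baseCumHazard, Polynomial.eval_finsetSum, Polynomial.eval_mul,
    Polynomial.eval_C, Polynomial.eval_pow, Polynomial.eval_X]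
  exact Finset.sum_congr rfl fun i _ => by ring

lemma eval_derivative_hazardPoly (θ : Param m) (t : ℝ) :
    (Polynomial.derivative (hazardPoly θ)).eval t = baseHazard θ t := by
  refine (Polynomial.hasDerivAt (hazardPoly θ) t).unique ?_
  have : (fun x => (hazardPoly θ).eval x) = baseCumHazard θ := funext (eval_hazardPoly θ)
  rw [this]
  exact hasDerivAt_baseCumHazard θ t

lemma natDegree_hazardPoly_le (θ : Param m) : (hazardPoly θ).natDegree ≤ m + 1 := by
  refine Polynomial.natDegree_sum_le_of_forall_le _ _ fun i _ => ?_
  exact (Polynomial.natDegree_C_mul_X_pow_le _ _).trans (by omega)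

lemma gam_eq_of_baseCumHazard_eq {θ θ' : Param m}
    (h : ∀ t, baseCumHazard θ t = baseCumHazard θ' t) (i : Fin (m + 1)) : gam θ i = gam θ' i := by
  have hp : hazardPoly θ = hazardPoly θ' :=
    Polynomial.funext fun t => by rw [eval_hazardPoly, eval_hazardPoly, h]
  have hc : ∀ θ : Param m, (hazardPoly θ).coeff ((i : ℕ) + 1) = gam θ i / ((i : ℕ) + 1) := by
    intro θ
    simp only [hazardPoly, Polynomial.finsetSum_coeff, Polynomial.coeff_C_mul_X_pow]
    rw [Finset.sum_eq_single i]
    · simp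
    · intro j _ hj
      rw [if_neg]
      intro hcon
      exact hj (Fin.ext (by omega))
    · simp
  have h1 := hc θ
  rw [hp, hc θ'] at h1
  have hne : (((i : ℕ) : ℝ) + 1) ≠ 0 := by positivity
  field_simp at h1
  exact h1.symm

lemma param_ext {θ θ' : Param m} (hs : slope θ = slope θ')
    (h : ∀ t, baseCumHazard θ t = baseCumHazard θ' t) : θ = θ' := by
  ext i
  refine Fin.lastCases hs (fun i => ?_) i
  exact gam_eq_of_baseCumHazard_eq h i

/-- The node t₀ = 0 counts too: there are k + 1 ≥ m + 2 zeros, more than the degree. -/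
lemma Design.eq_zero_of_eval_first_phase (hk : m + 1 ≤ (S.k : ℕ)) {p : Polynomial ℝ}
    (hp : p.natDegree ≤ m + 1) (h : ∀ j ≤ S.k, p.eval (S.t j) = 0) : p = 0 := by
  refine Polynomial.eq_zero_of_natDegree_lt_card_of_eval_eq_zero' p
    ((Finset.Iic S.k).image S.t) ?_ ?_
  · intro x hx
    obtain ⟨j, hj, rfl⟩ := Finset.mem_image.1 hx
    exact h j (Finset.mem_Iic.1 hj)
  · rw [Finset.card_image_of_injective _ S.t_strictMono.injective, Fin.card_Iic]
    omega

/-- Both endpoints t_k and t_L are nodes, giving L - k + 1 ≥ m + 2 zeros. The translation c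
accommodates the time shift. -/
lemma Design.eq_zero_of_eval_second_phase (hk : m + 1 ≤ L - (S.k : ℕ)) {p : Polynomial ℝ}
    (hp : p.natDegree ≤ m + 1) (c : ℝ) (h : ∀ j ≥ S.k, p.eval (S.t j + c) = 0) : p = 0 := by
  have hinj : Function.Injective fun j => S.t j + c :=
    (add_left_injective c).comp S.t_strictMono.injective
  refine Polynomial.eq_zero_of_natDegree_lt_card_of_eval_eq_zero' p
    ((Finset.Ici S.k).image fun j => S.t j + c) ?_ ?_
  · intro x hx
    obtain ⟨j, hj, rfl⟩ := Finset.mem_image.1 hx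
    exact h j (Finset.mem_Ici.1 hj)
  · rw [Finset.card_image_of_injective _ hinj, Fin.card_Ici]
    omega

/-- The difference vanishes for d = 0 and for e = 0, so de factors out; the cofactor has only
nonnegative terms, and a² makes it strictly positive. -/
lemma cubic_mul_lt {a b c u d e : ℝ} (ha : 0 < a) (hb : 0 ≤ b) (hc : 0 ≤ c) (hu : 0 < u)
    (hd : 0 < d) (he : 0 < e) :
    (a * (d + (u + e)) + b * (d + (u + e)) ^ 2 + c * (d + (u + e)) ^ 3)
        * (a * u + b * u ^ 2 + c * u ^ 3)
      < (a * (d + u) + b * (d + u) ^ 2 + c * (d + u) ^ 3)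
        * (a * (u + e) + b * (u + e) ^ 2 + c * (u + e) ^ 3) := by
  have key : (a * (d + u) + b * (d + u) ^ 2 + c * (d + u) ^ 3)
        * (a * (u + e) + b * (u + e) ^ 2 + c * (u + e) ^ 3)
      - (a * (d + (u + e)) + b * (d + (u + e)) ^ 2 + c * (d + (u + e)) ^ 3)
        * (a * u + b * u ^ 2 + c * u ^ 3)
      = d * e * (a ^ 2 + a * b * (2 * u + d + e)
        + b ^ 2 * ((u + d) * (u + e) + u * (u + d + e)) + a * c * (d ^ 2 + e ^ 2)
        + b * c * (((u + d) * (u + e) + u * (u + d + e)) * (2 * u + d + e))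
        + c ^ 2 * (((u + d) * (u + e)) ^ 2 + (u + d) * (u + e) * (u * (u + d + e))
          + (u * (u + d + e)) ^ 2)) := by ring
  have hpos : 0 < d * e * (a ^ 2 + a * b * (2 * u + d + e)
        + b ^ 2 * ((u + d) * (u + e) + u * (u + d + e)) + a * c * (d ^ 2 + e ^ 2)
        + b * c * (((u + d) * (u + e) + u * (u + d + e)) * (2 * u + d + e))
        + c ^ 2 * (((u + d) * (u + e)) ^ 2 + (u + d) * (u + e) * (u * (u + d + e))
          + (u * (u + d + e)) ^ 2)) := by positivity
  linarith

/-- The infinitesimal form of `cubic_mul_lt` (e tending to 0), proved separately to keep the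
inequality strict. -/
lemma cubic_deriv_mul_lt {a b c u d : ℝ} (ha : 0 < a) (hb : 0 ≤ b) (hc : 0 ≤ c) (hu : 0 < u)
    (hd : 0 < d) :
    (a * u + b * u ^ 2 + c * u ^ 3) * (a + 2 * b * (d + u) + 3 * c * (d + u) ^ 2)
      < (a * (d + u) + b * (d + u) ^ 2 + c * (d + u) ^ 3) * (a + 2 * b * u + 3 * c * u ^ 2) := by
  have key : (a * (d + u) + b * (d + u) ^ 2 + c * (d + u) ^ 3) * (a + 2 * b * u + 3 * c * u ^ 2)
      - (a * u + b * u ^ 2 + c * u ^ 3) * (a + 2 * b * (d + u) + 3 * c * (d + u) ^ 2)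
      = d * (a ^ 2 + a * b * (2 * u + d) + b ^ 2 * (2 * u * (u + d)) + a * c * d ^ 2
        + b * c * (2 * u * (u + d) * (2 * u + d)) + c ^ 2 * (3 * u ^ 2 * (u + d) ^ 2)) := by ring
  have hpos : 0 < d * (a ^ 2 + a * b * (2 * u + d) + b ^ 2 * (2 * u * (u + d)) + a * c * d ^ 2
        + b * c * (2 * u * (u + d) * (2 * u + d)) + c ^ 2 * (3 * u ^ 2 * (u + d) ^ 2)) := by
    positivity
  linarith

/-- For a linear or quadratic baseline hazard the cumulative hazard is a cubic polynomial. -/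
lemma exists_cubic (hm : m = 1 ∨ m = 2) {θ : Param m} (hθ : θ ∈ paramSpace m) :
    ∃ a b c : ℝ, 0 < a ∧ 0 ≤ b ∧ 0 ≤ c ∧ (∀ t, baseCumHazard θ t = a * t + b * t ^ 2 + c * t ^ 3) ∧
      ∀ t, baseHazard θ t = a + 2 * b * t + 3 * c * t ^ 2 := by
  rcases hm with rfl | rfl
  · refine ⟨gam θ 0, gam θ 1 / 2, 0, hθ _, div_nonneg (hθ _).le two_pos.le, le_rfl, fun t => ?_,
      fun t => ?_⟩
    · simp [baseCumHazard, Fin.sum_univ_succ]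
      ring
    · refine (Fin.sum_univ_two _).trans ?_
      simp only [Fin.val_zero, Fin.val_one]
      ring
  · refine ⟨gam θ 0, gam θ 1 / 2, gam θ 2 / 3, hθ _, div_nonneg (hθ _).le two_pos.le,
      div_nonneg (hθ _).le three_pos.le, fun t => ?_, fun t => ?_⟩
    · simp [baseCumHazard, Fin.sum_univ_succ]
      ring
    · simp [baseHazard, Fin.sum_univ_succ]
      ring

/-- Strict log-concavity of the cumulative baseline hazard. -/
lemma baseCumHazard_mul_lt (hm : m = 1 ∨ m = 2) {θ : Param m} (hθ : θ ∈ paramSpace m)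
    {u v d : ℝ} (hu : 0 < u) (huv : u < v) (hd : 0 < d) :
    baseCumHazard θ (d + v) * baseCumHazard θ u < baseCumHazard θ (d + u) * baseCumHazard θ v := by
  obtain ⟨a, b, c, ha, hb, hc, h, -⟩ := exists_cubic hm hθ
  have := cubic_mul_lt ha hb hc hu hd (sub_pos.2 huv)
  rw [add_sub_cancel] at this
  simpa only [h] using this

/-- The logarithmic derivative h₀/H₀ is strictly decreasing; this is the linearized counterpart of
`baseCumHazard_mul_lt`, needed for the rank of W. -/
lemma baseCumHazard_mul_baseHazard_lt (hm : m = 1 ∨ m = 2) {θ : Param m} (hθ : θ ∈ paramSpace m)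
    {u d : ℝ} (hu : 0 < u) (hd : 0 < d) :
    baseCumHazard θ u * baseHazard θ (d + u) < baseCumHazard θ (d + u) * baseHazard θ u := by
  obtain ⟨a, b, c, ha, hb, hc, h, h'⟩ := exists_cubic hm hθ
  simpa only [h, h'] using cubic_deriv_mul_lt ha hb hc hu hd

/-- Nothing need be known about `shift` here: a positive value of H₀ at any argument forces some γ_i
> 0. -/
lemma Design.baseCumHazard_pos_of_cumHazard_pos {θ : Param m} (hθ : ∀ i, 0 ≤ θ i)
    (h : 0 < S.cumHazard θ S.τ) : 0 < baseCumHazard θ S.τ := by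
  rw [Design.cumHazard, if_neg (lt_irrefl _)] at h
  have h1 := pos_of_mul_pos_right h (Real.exp_pos _).le
  exact baseCumHazard_pos hθ h1 S.τ_pos

lemma Design.slope_eq_of_exp {θ θ' : Param m}
    (h : Real.exp (slope θ * S.x₁) * Real.exp (slope θ' * S.x₂)
      = Real.exp (slope θ * S.x₂) * Real.exp (slope θ' * S.x₁)) : slope θ = slope θ' := by
  rw [← Real.exp_add, ← Real.exp_add, Real.exp_eq_exp] at h
  have h1 : (slope θ - slope θ') * (S.x₂ - S.x₁) = 0 := by linarith
  rcases mul_eq_zero.1 h1 with h2 | h2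
  · linarith
  · linarith [S.stress_lt]

/-- The first phase determines the polynomial exp(a₁x₁) H₀. The hazards at τ and t_L then determine
the ratio H₀(d + u) / H₀(u), strictly decreasing in u by log-concavity, so u is determined and with
it exp(a₁x₂)/exp(a₁x₁). -/
theorem Design.identifiableAt_of_first_phase (hm : m = 1 ∨ m = 2) (hk : m + 1 ≤ (S.k : ℕ))
    {θ₀ : Param m} (hθ₀ : θ₀ ∈ paramSpace m) : S.IdentifiableAt θ₀ := by
  intro θ hθ hπ
  have hH := S.cumHazard_eq_of_cellProb_eq hπ
  have hθ₀' : ∀ i, 0 ≤ θ₀ i := fun i => (hθ₀ i).le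
  have hp0 := baseCumHazard_pos_of_mem hθ₀ S.τ_pos
  have hCk : 0 < S.cumHazard θ₀ S.τ := by
    have := S.cumHazard_strictMono hθ₀ le_rfl S.τ_pos
    rwa [S.cumHazard_zero] at this
  have hp : 0 < baseCumHazard θ S.τ :=
    S.baseCumHazard_pos_of_cumHazard_pos hθ (by rw [Design.τ, hH]; exact hCk)
  obtain ⟨u, hu⟩ := S.exists_isEquivTime hθ
  obtain ⟨u₀, hu₀⟩ := S.exists_isEquivTime hθ₀'
  have hpoly : Polynomial.C (Real.exp (slope θ * S.x₁)) * hazardPoly θ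
      - Polynomial.C (Real.exp (slope θ₀ * S.x₁)) * hazardPoly θ₀ = 0 := by
    refine S.eq_zero_of_eval_first_phase hk ?_ fun j hj => ?_
    · exact (Polynomial.natDegree_sub_le_of_le
        ((Polynomial.natDegree_C_mul_le _ _).trans (natDegree_hazardPoly_le θ))
        ((Polynomial.natDegree_C_mul_le _ _).trans (natDegree_hazardPoly_le θ₀))).trans (by simp)
    · have hj' : S.t j ≤ S.τ := S.t_strictMono.monotone hj
      have := hH j
      rw [S.cumHazard_of_le hu hθ hp hj', S.cumHazard_of_le hu₀ hθ₀' hp0 hj'] at this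
      simp only [Polynomial.eval_sub, Polynomial.eval_mul, Polynomial.eval_C, eval_hazardPoly]
      linarith
  have hG : ∀ t, Real.exp (slope θ * S.x₁) * baseCumHazard θ t
      = Real.exp (slope θ₀ * S.x₁) * baseCumHazard θ₀ t := by
    intro t
    have := congrArg (Polynomial.eval t) hpoly
    simp only [Polynomial.eval_sub, Polynomial.eval_mul, Polynomial.eval_C, eval_hazardPoly,
      Polynomial.eval_zero] at this
    linarith
  set d := S.t (Fin.last L) - S.τ with hd
  have hd0 : 0 < d := sub_pos.2 S.τ_lt_last
  have hlast := hH (Fin.last L)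
  rw [S.cumHazard_of_ge hu hθ hp S.τ_lt_last.le, S.cumHazard_of_ge hu₀ hθ₀' hp0 S.τ_lt_last.le,
    ← hd] at hlast
  have hE := Real.exp_pos (slope θ * S.x₁)
  have hF := Real.exp_pos (slope θ * S.x₂)
  have hE₀ := Real.exp_pos (slope θ₀ * S.x₁)
  have hF₀ := Real.exp_pos (slope θ₀ * S.x₂)
  have hmid : Real.exp (slope θ * S.x₂) * baseCumHazard θ u
      = Real.exp (slope θ₀ * S.x₂) * baseCumHazard θ₀ u₀ := by
    rw [hu.2.2, hu₀.2.2, hG]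
  have hθeq : ∀ t, baseCumHazard θ t = Real.exp (slope θ₀ * S.x₁) / Real.exp (slope θ * S.x₁)
      * baseCumHazard θ₀ t := by
    intro t
    rw [div_mul_eq_mul_div, eq_div_iff hE.ne', mul_comm, hG]
  have hcross : baseCumHazard θ₀ (d + u) * baseCumHazard θ₀ u₀
      = baseCumHazard θ₀ (d + u₀) * baseCumHazard θ₀ u := by
    rw [hθeq] at hlast hmid
    have hc : 0 < Real.exp (slope θ * S.x₂) * (Real.exp (slope θ₀ * S.x₁)
        / Real.exp (slope θ * S.x₁)) * Real.exp (slope θ₀ * S.x₂) := by positivity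
    refine mul_left_cancel₀ hc.ne' ?_
    calc _ = (Real.exp (slope θ * S.x₂) * (Real.exp (slope θ₀ * S.x₁) / Real.exp (slope θ * S.x₁)
            * baseCumHazard θ₀ (d + u))) * (Real.exp (slope θ₀ * S.x₂) * baseCumHazard θ₀ u₀) := by
          ring
      _ = _ := by rw [hlast, ← hmid]; ring
  have huu : u = u₀ := by
    rcases lt_trichotomy u u₀ with h | h | h
    · exact absurd hcross (baseCumHazard_mul_lt hm hθ₀ (hu.pos S hp) h hd0).ne'
    · exact h
    · exact absurd hcross (baseCumHazard_mul_lt hm hθ₀ (hu₀.pos S hp0) h hd0).ne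
  have hu0 := hu₀.pos S hp0
  have hs : slope θ = slope θ₀ := by
    refine S.slope_eq_of_exp ?_
    rw [hθeq, huu] at hmid
    have hB := baseCumHazard_pos_of_mem hθ₀ hu0
    rw [← mul_assoc] at hmid
    have := mul_right_cancel₀ hB.ne' hmid
    rw [← this]
    field_simp
  refine param_ext hs fun t => ?_
  have := hG t
  rw [hs] at this
  exact mul_left_cancel₀ hE₀.ne' this

/-- The second phase determines the polynomial v ↦ exp(a₁x₂) H₀(v + u), which vanishes at -u and is
positive to the right; this fixes u. Comparison with the hazard at τ in first-phase form fixes a₁.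
Log-concavity plays no role. -/
theorem Design.identifiableAt_of_second_phase (hk : m + 1 ≤ L - (S.k : ℕ))
    {θ₀ : Param m} (hθ₀ : θ₀ ∈ paramSpace m) : S.IdentifiableAt θ₀ := by
  intro θ hθ hπ
  have hH := S.cumHazard_eq_of_cellProb_eq hπ
  have hθ₀' : ∀ i, 0 ≤ θ₀ i := fun i => (hθ₀ i).le
  have hp0 := baseCumHazard_pos_of_mem hθ₀ S.τ_pos
  have hCk : 0 < S.cumHazard θ₀ S.τ := by
    have := S.cumHazard_strictMono hθ₀ le_rfl S.τ_pos
    rwa [S.cumHazard_zero] at this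
  have hp : 0 < baseCumHazard θ S.τ :=
    S.baseCumHazard_pos_of_cumHazard_pos hθ (by rw [Design.τ, hH]; exact hCk)
  obtain ⟨u, hu⟩ := S.exists_isEquivTime hθ
  obtain ⟨u₀, hu₀⟩ := S.exists_isEquivTime hθ₀'
  have hdeg : ∀ (θ : Param m) (c w : ℝ), (Polynomial.C c *
      (hazardPoly θ).comp (Polynomial.X + Polynomial.C w)).natDegree ≤ m + 1 := by
    intro θ c w
    refine (Polynomial.natDegree_C_mul_le _ _).trans ?_
    rw [Polynomial.natDegree_comp, Polynomial.natDegree_X_add_C, mul_one]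
    exact natDegree_hazardPoly_le θ
  have hpoly : Polynomial.C (Real.exp (slope θ * S.x₂)) *
        (hazardPoly θ).comp (Polynomial.X + Polynomial.C u)
      - Polynomial.C (Real.exp (slope θ₀ * S.x₂)) *
        (hazardPoly θ₀).comp (Polynomial.X + Polynomial.C u₀) = 0 := by
    refine S.eq_zero_of_eval_second_phase hk ?_ (-S.τ) fun j hj => ?_
    · exact (Polynomial.natDegree_sub_le_of_le (hdeg _ _ _) (hdeg _ _ _)).trans (by simp)
    · have hj' : S.τ ≤ S.t j := S.t_strictMono.monotone hj
      have := hH j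
      rw [S.cumHazard_of_ge hu hθ hp hj', S.cumHazard_of_ge hu₀ hθ₀' hp0 hj'] at this
      simp only [Polynomial.eval_sub, Polynomial.eval_mul, Polynomial.eval_C, Polynomial.eval_comp,
        Polynomial.eval_add, Polynomial.eval_X, eval_hazardPoly, ← sub_eq_add_neg]
      linarith
  have hF : ∀ v, Real.exp (slope θ * S.x₂) * baseCumHazard θ (v + u)
      = Real.exp (slope θ₀ * S.x₂) * baseCumHazard θ₀ (v + u₀) := by
    intro v
    have := congrArg (Polynomial.eval v) hpoly
    simp only [Polynomial.eval_sub, Polynomial.eval_mul, Polynomial.eval_C, Polynomial.eval_comp,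
      Polynomial.eval_add, Polynomial.eval_X, eval_hazardPoly, Polynomial.eval_zero] at this
    linarith
  have huu : u = u₀ := by
    rcases lt_trichotomy u u₀ with h | h | h
    · have h1 := hF (-u)
      rw [neg_add_cancel, baseCumHazard_zero, mul_zero] at h1
      have h2 : 0 < Real.exp (slope θ₀ * S.x₂) * baseCumHazard θ₀ (-u + u₀) :=
        mul_pos (Real.exp_pos _) (baseCumHazard_pos_of_mem hθ₀ (by linarith))
      linarith
    · exact h
    · have h1 := hF (-u₀)
      rw [neg_add_cancel, baseCumHazard_zero, mul_zero] at h1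
      have h2 : 0 < Real.exp (slope θ * S.x₂) * baseCumHazard θ (-u₀ + u) :=
        mul_pos (Real.exp_pos _) (baseCumHazard_pos hθ hp (by linarith))
      linarith
  have hG : ∀ t, Real.exp (slope θ * S.x₂) * baseCumHazard θ t
      = Real.exp (slope θ₀ * S.x₂) * baseCumHazard θ₀ t := by
    intro t
    have := hF (t - u)
    rwa [← huu, sub_add_cancel] at this
  have hs : slope θ = slope θ₀ := by
    refine S.slope_eq_of_exp ?_
    have h1 : Real.exp (slope θ * S.x₁) * baseCumHazard θ S.τ
        = Real.exp (slope θ₀ * S.x₁) * baseCumHazard θ₀ S.τ := by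
      rw [← hu.2.2, ← hu₀.2.2, ← huu, hG]
    have h2 := hG S.τ
    refine mul_right_cancel₀ (mul_pos hp hp0).ne' ?_
    calc _ = (Real.exp (slope θ * S.x₁) * baseCumHazard θ S.τ)
          * (Real.exp (slope θ₀ * S.x₂) * baseCumHazard θ₀ S.τ) := by ring
      _ = _ := by rw [h1, ← h2]; ring
  refine param_ext hs fun t => ?_
  have := hG t
  rw [hs] at this
  exact mul_left_cancel₀ (Real.exp_pos _).ne' this

/-! ### The Jacobian matrix has full column rank -/

lemma baseCumHazard_add_smul (θ v : Param m) (r t : ℝ) :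
    baseCumHazard (θ + r • v) t = baseCumHazard θ t + r * baseCumHazard v t := by
  simp only [baseCumHazard, gam, PiLp.add_apply, PiLp.smul_apply, smul_eq_mul]
  rw [Finset.mul_sum, ← Finset.sum_add_distrib]
  exact Finset.sum_congr rfl fun i _ => by ring

lemma slope_add_smul (θ v : Param m) (r : ℝ) : slope (θ + r • v) = slope θ + r * slope v := by
  simp [slope]

/-- The linear equations for a direction in which the derivatives of the cell probabilities
vanish. -/
lemma Design.exists_kernel_equations {θ₀ v : Param m} (hθ₀ : θ₀ ∈ paramSpace m)
    (hv : ∀ j, fderiv ℝ (fun θ : Param m => S.cellProb θ j) θ₀ v = 0) :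
    ∃ u u' : ℝ, 0 < u ∧ (∀ j ≤ S.k, slope v * S.x₁ * baseCumHazard θ₀ (S.t j)
        + baseCumHazard v (S.t j) = 0) ∧
      ∀ j ≥ S.k, slope v * S.x₂ * baseCumHazard θ₀ (S.t j + (u - S.τ))
        + u' * baseHazard θ₀ (S.t j + (u - S.τ)) + baseCumHazard v (S.t j + (u - S.τ)) = 0 := by
  have hline : HasDerivAt (fun r : ℝ => θ₀ + r • v) v 0 := by
    simpa using ((hasDerivAt_id (0 : ℝ)).smul_const v).const_add θ₀
  have hline0 : θ₀ + (0 : ℝ) • v = θ₀ := by simp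
  have hπ : ∀ j, HasDerivAt (fun r : ℝ => S.cellProb (θ₀ + r • v) j) 0 0 := by
    intro j
    have h1 : DifferentiableAt ℝ (fun θ : Param m => S.cellProb θ j) (θ₀ + (0 : ℝ) • v) := by
      rw [hline0]
      exact differentiableAt_pi.1 (S.differentiableAt_cellProb hθ₀) j
    have h2 := h1.hasFDerivAt.comp_hasDerivAt (0 : ℝ) hline
    rw [hline0, hv j] at h2
    exact h2
  -- Through the logarithm, vanishing derivatives of the cell probabilities become vanishing
  -- derivatives of the hazards.
  have hH : ∀ j, HasDerivAt (fun r : ℝ => S.cumHazard (θ₀ + r • v) (S.t j)) 0 0 := by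
    intro j
    simp only [S.cumHazard_t]
    have h1 : HasDerivAt (fun r : ℝ => 1 - ∑ i ∈ Finset.Iio j, S.cellProb (θ₀ + r • v) i) 0 0 := by
      simpa using (HasDerivAt.fun_sum (u := Finset.Iio j) fun i _ => hπ i).const_sub 1
    have h2 : 1 - ∑ i ∈ Finset.Iio j, S.cellProb (θ₀ + (0 : ℝ) • v) i ≠ 0 := by
      rw [← S.reliability_t]
      exact (Real.exp_pos _).ne'
    simpa using (h1.log h2).fun_neg
  have hs : DifferentiableAt ℝ (fun r : ℝ => S.shift (θ₀ + r • v)) 0 := by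
    have h1 : DifferentiableAt ℝ (fun θ : Param m => S.shift θ) (θ₀ + (0 : ℝ) • v) := by
      rw [hline0]
      exact S.differentiableAt_shift hθ₀
    exact DifferentiableAt.comp (g := fun θ : Param m => S.shift θ) (0 : ℝ) h1
      hline.differentiableAt
  have hθ₀' : ∀ i, 0 ≤ θ₀ i := fun i => (hθ₀ i).le
  have hp0 := baseCumHazard_pos_of_mem hθ₀ S.τ_pos
  obtain ⟨u, hu⟩ := S.exists_isEquivTime hθ₀'
  have hshift := hu.shift_eq S hθ₀' hp0
  have hexp : ∀ x : ℝ, HasDerivAt (fun r : ℝ => Real.exp ((slope θ₀ + r * slope v) * x))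
      (Real.exp (slope θ₀ * x) * (slope v * x)) 0 := by
    intro x
    have h1 : HasDerivAt (fun r : ℝ => (slope θ₀ + r * slope v) * x) (1 * slope v * x) 0 :=
      (((hasDerivAt_id (0 : ℝ)).mul_const (slope v)).const_add (slope θ₀)).mul_const x
    simpa using h1.exp
  refine ⟨u, deriv (fun r : ℝ => S.shift (θ₀ + r • v)) 0, hu.pos S hp0, fun j hj => ?_,
    fun j hj => ?_⟩
  · have hj' : S.t j ≤ S.τ := S.t_strictMono.monotone hj
    have hB : HasDerivAt (fun r : ℝ => baseCumHazard θ₀ (S.t j) + r * baseCumHazard v (S.t j))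
        (baseCumHazard v (S.t j)) 0 := by
      simpa using ((hasDerivAt_id (0 : ℝ)).mul_const (baseCumHazard v (S.t j))).const_add
        (baseCumHazard θ₀ (S.t j))
    have hprod := (hexp S.x₁).mul hB
    -- At t_j = τ the definition takes the second branch; `cumHazard_of_le` converts it to
    -- first-phase form as long as θ₀ + r v stays in the parameter space.
    have heq : (fun r : ℝ => S.cumHazard (θ₀ + r • v) (S.t j)) =ᶠ[𝓝 0]
        (fun r : ℝ => Real.exp ((slope θ₀ + r * slope v) * S.x₁))
          * fun r : ℝ => baseCumHazard θ₀ (S.t j) + r * baseCumHazard v (S.t j) := by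
      have hmem : ∀ᶠ r in 𝓝 (0 : ℝ), θ₀ + r • v ∈ paramSpace m :=
        hline.continuousAt.eventually_mem (by rw [hline0]; exact isOpen_paramSpace.mem_nhds hθ₀)
      filter_upwards [hmem] with r hr
      obtain ⟨w, hw⟩ := S.exists_isEquivTime fun i => (hr i).le
      rw [S.cumHazard_of_le hw (fun i => (hr i).le) (baseCumHazard_pos_of_mem hr S.τ_pos) hj',
        slope_add_smul, baseCumHazard_add_smul]
      rfl
    have h0 := (hprod.congr_of_eventuallyEq heq).unique (hH j)
    simp only [zero_mul, add_zero] at h0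
    have hE := Real.exp_pos (slope θ₀ * S.x₁)
    refine mul_left_cancel₀ hE.ne' ?_
    rw [mul_zero, ← h0]
    ring
  · have hj' : S.τ ≤ S.t j := S.t_strictMono.monotone hj
    set u' := deriv (fun r : ℝ => S.shift (θ₀ + r • v)) 0 with hu'
    have hg : HasDerivAt (fun r : ℝ => S.t j + S.shift (θ₀ + r • v)) u' 0 :=
      hs.hasDerivAt.const_add _
    have hg0 : S.t j + S.shift (θ₀ + (0 : ℝ) • v) = S.t j + (u - S.τ) := by rw [hline0, hshift]
    have hcomp : ∀ θ : Param m, HasDerivAt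
        (fun r : ℝ => baseCumHazard θ (S.t j + S.shift (θ₀ + r • v)))
        (baseHazard θ (S.t j + (u - S.τ)) * u') 0 := by
      intro θ
      have h1 := hasDerivAt_baseCumHazard θ (S.t j + S.shift (θ₀ + (0 : ℝ) • v))
      have h2 := h1.comp (0 : ℝ) hg
      rwa [hg0] at h2
    have hprod := (hexp S.x₂).mul ((hcomp θ₀).add ((hasDerivAt_id (0 : ℝ)).mul (hcomp v)))
    have heq : (fun r : ℝ => S.cumHazard (θ₀ + r • v) (S.t j)) =
        (fun r : ℝ => Real.exp ((slope θ₀ + r * slope v) * S.x₂))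
          * ((fun r : ℝ => baseCumHazard θ₀ (S.t j + S.shift (θ₀ + r • v)))
            + id * fun r : ℝ => baseCumHazard v (S.t j + S.shift (θ₀ + r • v))) := by
      funext r
      rw [Design.cumHazard, if_neg (not_lt.2 hj'), slope_add_smul, baseCumHazard_add_smul]
      rfl
    rw [← heq] at hprod
    have h0 := hprod.unique (hH j)
    simp only [Pi.add_apply, Pi.mul_apply, id, zero_mul, add_zero, one_mul] at h0
    rw [hline0, hshift] at h0
    have hE := Real.exp_pos (slope θ₀ * S.x₂)
    refine mul_left_cancel₀ hE.ne' ?_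
    rw [mul_zero, ← h0]
    ring

lemma param_eq_zero {v : Param m} (hs : slope v = 0) (h : ∀ t, baseCumHazard v t = 0) : v = 0 :=
  param_ext (by simpa [slope] using hs) fun t => by
    rw [h]
    simp [baseCumHazard, gam]

/-- The differential of the cell probabilities is injective if one of the stress phases has at
least `m + 1` inspection times. -/
theorem Design.eq_zero_of_fderiv_cellProb_eq_zero (hm : m = 1 ∨ m = 2)
    (hk : m + 1 ≤ (S.k : ℕ) ∨ m + 1 ≤ L - (S.k : ℕ)) {θ₀ v : Param m} (hθ₀ : θ₀ ∈ paramSpace m)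
    (hv : ∀ j, fderiv ℝ (fun θ : Param m => S.cellProb θ j) θ₀ v = 0) : v = 0 := by
  obtain ⟨u, u', hu, h1, h2⟩ := S.exists_kernel_equations hθ₀ hv
  have hx : 0 < S.x₂ - S.x₁ := sub_pos.2 S.stress_lt
  have hdeg : ∀ (θ : Param m) (c : ℝ), (Polynomial.C c * hazardPoly θ).natDegree ≤ m + 1 :=
    fun θ c => (Polynomial.natDegree_C_mul_le _ _).trans (natDegree_hazardPoly_le θ)
  rcases hk with hk | hk
  · have hpoly : Polynomial.C (slope v * S.x₁) * hazardPoly θ₀ + hazardPoly v = 0 := by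
      refine S.eq_zero_of_eval_first_phase hk ?_ fun j hj => ?_
      · exact (Polynomial.natDegree_add_le_of_le (hdeg _ _) (natDegree_hazardPoly_le v)).trans
          (by simp)
      · simpa [eval_hazardPoly] using h1 j hj
    have hG : ∀ t, slope v * S.x₁ * baseCumHazard θ₀ t + baseCumHazard v t = 0 := by
      intro t
      simpa [eval_hazardPoly] using congrArg (Polynomial.eval t) hpoly
    set d := S.t (Fin.last L) - S.τ with hd
    have hd0 : 0 < d := sub_pos.2 S.τ_lt_last
    have e1 := h2 S.k le_rfl
    have e2 := h2 (Fin.last L) (Fin.le_last _)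
    have ek : S.t S.k + (u - S.τ) = u := by rw [Design.τ]; ring
    have el : S.t (Fin.last L) + (u - S.τ) = d + u := by rw [hd]; ring
    rw [ek] at e1
    rw [el] at e2
    have hlt := baseCumHazard_mul_baseHazard_lt hm hθ₀ hu hd0
    have hs : slope v = 0 := by
      have f1 := hG u
      have f2 := hG (d + u)
      -- Subtracting the first-phase identity at u and d + u and eliminating u' leaves the slope
      -- times a factor that is positive by log-concavity.
      have hz : slope v * ((S.x₂ - S.x₁) * (baseCumHazard θ₀ (d + u) * baseHazard θ₀ u
          - baseCumHazard θ₀ u * baseHazard θ₀ (d + u))) = 0 := by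
        linear_combination baseHazard θ₀ u * (e2 - f2) - baseHazard θ₀ (d + u) * (e1 - f1)
      have hpos : 0 < (S.x₂ - S.x₁) * (baseCumHazard θ₀ (d + u) * baseHazard θ₀ u
          - baseCumHazard θ₀ u * baseHazard θ₀ (d + u)) := mul_pos hx (sub_pos.2 hlt)
      exact (mul_eq_zero.1 hz).resolve_right hpos.ne'
    refine param_eq_zero hs fun t => ?_
    simpa [hs] using hG t
  · have hpoly : Polynomial.C (slope v * S.x₂) * hazardPoly θ₀
        + Polynomial.C u' * Polynomial.derivative (hazardPoly θ₀) + hazardPoly v = 0 := by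
      refine S.eq_zero_of_eval_second_phase hk ?_ (u - S.τ) fun j hj => ?_
      · have hder : (Polynomial.C u' * Polynomial.derivative (hazardPoly θ₀)).natDegree ≤ m + 1 :=
          (Polynomial.natDegree_C_mul_le _ _).trans ((Polynomial.natDegree_derivative_le _).trans
            ((Nat.sub_le _ _).trans (natDegree_hazardPoly_le θ₀)))
        exact (Polynomial.natDegree_add_le_of_le (Polynomial.natDegree_add_le_of_le (hdeg _ _) hder)
          (natDegree_hazardPoly_le v)).trans (by simp)
      · simpa [eval_hazardPoly, eval_derivative_hazardPoly] using h2 j hj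
    have hG : ∀ t, slope v * S.x₂ * baseCumHazard θ₀ t + u' * baseHazard θ₀ t
        + baseCumHazard v t = 0 := by
      intro t
      simpa [eval_hazardPoly, eval_derivative_hazardPoly] using congrArg (Polynomial.eval t) hpoly
    -- At t = 0 only the term u' h₀(0) survives.
    have hu' : u' = 0 := by
      have h0 := hG 0
      rw [baseCumHazard_zero, baseCumHazard_zero, mul_zero, zero_add, add_zero] at h0
      exact (mul_eq_zero.1 h0).resolve_right (baseHazard_pos hθ₀ le_rfl).ne'
    have hs : slope v = 0 := by
      have e1 := h1 S.k le_rfl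
      have e2 := hG S.τ
      rw [hu', zero_mul, add_zero] at e2
      change slope v * S.x₁ * baseCumHazard θ₀ S.τ + baseCumHazard v S.τ = 0 at e1
      have hz : slope v * ((S.x₂ - S.x₁) * baseCumHazard θ₀ S.τ) = 0 := by
        linear_combination e2 - e1
      exact (mul_eq_zero.1 hz).resolve_right
        (mul_pos hx (baseCumHazard_pos_of_mem hθ₀ S.τ_pos)).ne'
    refine param_eq_zero hs fun t => ?_
    simpa [hs, hu'] using hG t

/-! ### The matrices of the asymptotic distribution -/

lemma Design.W_mulVec (θ : Param m) (v : Param m) (j : Fin (L + 1)) :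
    (S.W θ).mulVec v.ofLp j = fderiv ℝ (fun θ' : Param m => S.cellProb θ' j) θ v := by
  have hv : v = ∑ i, v i • EuclideanSpace.single i (1 : ℝ) := by
    ext i
    simp [Finset.sum_apply, Pi.single_apply]
  conv_rhs => rw [hv]
  rw [map_sum]
  simp only [map_smul, smul_eq_mul, Matrix.mulVec, dotProduct, Design.W, Matrix.of_apply,
    partialDeriv]
  exact Finset.sum_congr rfl fun i _ => mul_comm _ _

lemma Design.dotProduct_J_mulVec (β : ℝ) (θ : Param m) (v w : Fin (m + 2) → ℝ) :
    v ⬝ᵥ (S.J β θ).mulVec w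
      = ∑ j, S.cellProb θ j ^ (β - 1) * ((S.W θ).mulVec v j * (S.W θ).mulVec w j) := by
  rw [Design.J, ← Matrix.mulVec_mulVec, ← Matrix.mulVec_mulVec, Matrix.dotProduct_mulVec,
    Matrix.vecMul_transpose, dotProduct]
  refine Finset.sum_congr rfl fun j _ => ?_
  rw [Design.Dpow, Matrix.mulVec_diagonal]
  ring

lemma Design.transpose_J (β : ℝ) (θ : Param m) : (S.J β θ).transpose = S.J β θ := by
  rw [Design.J, Matrix.transpose_mul, Matrix.transpose_mul, Matrix.transpose_transpose,
    Design.Dpow, Matrix.diagonal_transpose, Matrix.mul_assoc]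

/-- The quadratic form of J_β at v is a sum of squares of (Wv)_j with positive weights. The
criterion is free of β, so nonsingularity transfers to β = 0. -/
lemma Design.isUnit_det_J_iff (β : ℝ) {θ : Param m} (hθ : θ ∈ paramSpace m) :
    IsUnit (S.J β θ).det ↔ Function.Injective (S.W θ).mulVec := by
  rw [← Matrix.isUnit_iff_isUnit_det, ← Matrix.mulVec_injective_iff_isUnit]
  constructor
  · intro h v w hvw
    refine h ?_
    simp only [Design.J, ← Matrix.mulVec_mulVec, hvw]
  · intro h
    have hker : ∀ v, (S.J β θ).mulVec v = 0 → v = 0 := by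
      intro v hv
      have h1 := S.dotProduct_J_mulVec β θ v v
      rw [hv, dotProduct_zero] at h1
      have hp : ∀ j, 0 < S.cellProb θ j ^ (β - 1) := fun j =>
        Real.rpow_pos_of_pos (S.cellProb_pos hθ j) _
      have h2 := (Finset.sum_eq_zero_iff_of_nonneg fun j _ =>
        mul_nonneg (hp j).le (mul_self_nonneg _)).1 h1.symm
      refine h ?_
      rw [Matrix.mulVec_zero]
      funext j
      exact mul_self_eq_zero.1 ((mul_eq_zero.1 (h2 j (Finset.mem_univ j))).resolve_left (hp j).ne')
    intro v w hvw
    have := hker (v - w) (by rw [Matrix.mulVec_sub]; exact sub_eq_zero.2 hvw)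
    exact sub_eq_zero.1 this

lemma Design.injective_W_mulVec (hm : m = 1 ∨ m = 2)
    (hk : m + 1 ≤ (S.k : ℕ) ∨ m + 1 ≤ L - (S.k : ℕ)) {θ₀ : Param m} (hθ₀ : θ₀ ∈ paramSpace m) :
    Function.Injective (S.W θ₀).mulVec := by
  intro v w hvw
  have h0 : (WithLp.toLp 2 (v - w) : Param m) = 0 := by
    refine S.eq_zero_of_fderiv_cellProb_eq_zero hm hk hθ₀ fun j => ?_
    rw [← S.W_mulVec, Matrix.mulVec_sub, hvw, sub_self]
    rfl
  have h1 := congrArg WithLp.ofLp h0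
  exact sub_eq_zero.1 h1

/-- The covariance matrix of a single multinomial trial. -/
def multinomialCov {ι : Type*} [Fintype ι] [DecidableEq ι] (p : ι → ℝ) : Matrix ι ι ℝ :=
  Matrix.diagonal p - Matrix.vecMulVec p p

lemma dotProduct_multinomialCov {ι : Type*} [Fintype ι] [DecidableEq ι] (p x : ι → ℝ) :
    x ⬝ᵥ (multinomialCov p).mulVec x = ∑ j, p j * x j ^ 2 - (∑ j, p j * x j) ^ 2 := by
  rw [multinomialCov, Matrix.sub_mulVec, dotProduct_sub]
  congr 1
  · simp only [dotProduct, Matrix.mulVec_diagonal]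
    exact Finset.sum_congr rfl fun j _ => by ring
  · rw [Matrix.dotProduct_mulVec, Matrix.vecMul_vecMulVec, smul_dotProduct, smul_eq_mul, sq]
    congr 1
    simp only [dotProduct]
    exact Finset.sum_congr rfl fun j _ => by ring

lemma posSemidef_multinomialCov {ι : Type*} [Fintype ι] [DecidableEq ι] {p : ι → ℝ}
    (hp : ∀ j, 0 ≤ p j) (hs : ∑ j, p j = 1) : (multinomialCov p).PosSemidef := by
  refine Matrix.PosSemidef.of_dotProduct_mulVec_nonneg ?_ fun x => ?_
  · rw [Matrix.IsHermitian, multinomialCov, Matrix.conjTranspose_sub,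
      Matrix.conjTranspose_vecMulVec, Matrix.diagonal_conjTranspose]
    simp
  · rw [star_trivial, dotProduct_multinomialCov]
    set c := ∑ j, p j * x j with hc
    have : ∑ j, p j * (x j - c) ^ 2 = ∑ j, p j * x j ^ 2 - c ^ 2 := by
      have e : ∀ j, p j * (x j - c) ^ 2 = p j * x j ^ 2 - 2 * c * (p j * x j) + c ^ 2 * p j :=
        fun j => by ring
      simp only [e, Finset.sum_add_distrib, Finset.sum_sub_distrib, ← Finset.mul_sum, hs, ← hc]
      ring
    rw [← this]
    exact Finset.sum_nonneg fun j _ => mul_nonneg (hp j) (sq_nonneg _)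

/-- The derivative of the minimum density power divergence functional. -/
def Design.influence (β : ℝ) (θ : Param m) : Matrix (Fin (m + 2)) (Fin (L + 1)) ℝ :=
  (S.J β θ)⁻¹ * (S.W θ).transpose * S.Dpow θ (β - 1)

/-- The middle factor is D^(β-1) (D - π πᵀ) D^(β-1), which exhibits Σ_β as the multinomial
covariance transported by `influence`. -/
lemma Design.K_eq (β : ℝ) {θ : Param m} (hθ : θ ∈ paramSpace m) :
    S.K β θ = (S.W θ).transpose * S.Dpow θ (β - 1) * multinomialCov (S.cellProb θ)
      * (S.Dpow θ (β - 1) * S.W θ) := by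
  have hpos := S.cellProb_pos hθ
  have e : S.Dpow θ (2 * β - 1) -
      Matrix.vecMulVec (fun j => S.cellProb θ j ^ β) (fun j => S.cellProb θ j ^ β)
      = S.Dpow θ (β - 1) * multinomialCov (S.cellProb θ) * S.Dpow θ (β - 1) := by
    rw [multinomialCov, Matrix.mul_sub, Matrix.sub_mul]
    congr 1
    · simp only [Design.Dpow, Matrix.diagonal_mul_diagonal]
      congr 1
      funext j
      have h1 : S.cellProb θ j ^ (2 * β - 1)
          = S.cellProb θ j ^ (β - 1) * S.cellProb θ j ^ (1 : ℝ) * S.cellProb θ j ^ (β - 1) := by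
        rw [← Real.rpow_add (hpos j), ← Real.rpow_add (hpos j)]
        congr 1
        ring
      rw [h1, Real.rpow_one]
    · ext i j
      have h1 : ∀ j, S.cellProb θ j ^ β = S.cellProb θ j ^ (β - 1) * S.cellProb θ j := fun j => by
        rw [← Real.rpow_add_one (hpos j).ne', sub_add_cancel]
      simp only [Design.Dpow, Matrix.mul_diagonal, Matrix.diagonal_mul, Matrix.vecMulVec_apply, h1]
      ring
  rw [Design.K, e]
  simp only [Matrix.mul_assoc]

lemma Design.asympCov_eq (β : ℝ) {θ : Param m} (hθ : θ ∈ paramSpace m) :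
    S.asympCov β θ = S.influence β θ * multinomialCov (S.cellProb θ)
      * (S.influence β θ).transpose := by
  have h1 : (S.influence β θ).transpose = S.Dpow θ (β - 1) * S.W θ * (S.J β θ)⁻¹ := by
    rw [Design.influence, Matrix.transpose_mul, Matrix.transpose_mul, Matrix.transpose_transpose,
      Matrix.transpose_nonsing_inv, S.transpose_J, Design.Dpow, Matrix.diagonal_transpose,
      Matrix.mul_assoc]
  rw [h1, Design.asympCov, S.K_eq β hθ, Design.influence]
  simp only [Matrix.mul_assoc]

lemma Design.posSemidef_asympCov (β : ℝ) {θ : Param m} (hθ : θ ∈ paramSpace m) :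
    (S.asympCov β θ).PosSemidef := by
  rw [S.asympCov_eq β hθ, ← Matrix.conjTranspose_eq_transpose_of_trivial]
  exact (posSemidef_multinomialCov (fun j => (S.cellProb_pos hθ j).le)
    (S.sum_cellProb θ)).mul_mul_conjTranspose_same _

/-- The continuous linear map of a real matrix between Euclidean spaces. -/
def matrixCLM {ι κ : Type*} [Fintype ι] [Fintype κ] [DecidableEq ι] (A : Matrix κ ι ℝ) :
    EuclideanSpace ℝ ι →L[ℝ] EuclideanSpace ℝ κ :=
  LinearMap.toContinuousLinearMap (Matrix.toEuclideanLin A)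

lemma matrixCLM_apply {ι κ : Type*} [Fintype ι] [Fintype κ] [DecidableEq ι] (A : Matrix κ ι ℝ)
    (z : EuclideanSpace ℝ ι) : (matrixCLM A z).ofLp = A.mulVec z.ofLp := rfl

lemma adjoint_matrixCLM_apply {ι κ : Type*} [Fintype ι] [Fintype κ] [DecidableEq ι]
    [DecidableEq κ] (A : Matrix κ ι ℝ) (t : EuclideanSpace ℝ κ) :
    (ContinuousLinearMap.adjoint (matrixCLM A) t).ofLp = A.transpose.mulVec t.ofLp := by
  have h : ContinuousLinearMap.adjoint (matrixCLM A) = matrixCLM A.transpose := by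
    symm
    rw [ContinuousLinearMap.eq_adjoint_iff]
    intro x y
    simp only [EuclideanSpace.inner_eq_star_dotProduct, matrixCLM_apply, star_trivial]
    rw [Matrix.dotProduct_mulVec, Matrix.vecMul_transpose, dotProduct_comm]
  rw [h, matrixCLM_apply]

/-! ### The case `β = 0` -/

lemma Design.isMDPDE_zero_iff (v : Fin (L + 1) → ℕ) (θ : Param m) :
    S.IsMDPDE 0 v θ ↔ S.IsMLE v θ := by
  refine and_congr_right fun hθ => ?_
  set N : ℝ := ∑ i, (v i : ℝ) with hN
  rcases eq_or_ne N 0 with h0 | h0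
  -- Without observations the empirical vector is 0 by the convention for division by zero, and both
  -- objectives are constant.
  · have hv : ∀ j, (v j : ℝ) = 0 := fun j =>
      (Finset.sum_eq_zero_iff_of_nonneg fun i _ => Nat.cast_nonneg (v i)).1 h0 j (Finset.mem_univ j)
    simp [isMinOn_iff, isMaxOn_iff, dpd, empirical, hv]
  · have hNpos : 0 < N :=
      lt_of_le_of_ne (Finset.sum_nonneg fun i _ => Nat.cast_nonneg (v i)) h0.symm
    have key : ∀ θ' ∈ paramSpace m, dpd 0 (empirical v) (S.cellProb θ')
        = ∑ j, empirical v j * Real.log (empirical v j)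
          - (∑ j, (v j : ℝ) * Real.log (S.cellProb θ' j)) / N := by
      intro θ' hθ'
      rw [dpd, if_pos rfl, Finset.sum_div, ← Finset.sum_sub_distrib]
      refine Finset.sum_congr rfl fun j _ => ?_
      rcases eq_or_ne (empirical v j) 0 with h1 | h1
      · have h2 : (v j : ℝ) = 0 := by
          rw [empirical, div_eq_zero_iff] at h1
          exact h1.resolve_right h0
        rw [h1, h2]
        simp
      · rw [Real.log_div h1 (S.cellProb_pos hθ' j).ne', mul_sub]
        simp only [empirical, ← hN]
        ring
    rw [isMinOn_iff, isMaxOn_iff]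
    refine forall₂_congr fun θ' hθ' => ?_
    rw [key θ hθ, key θ' hθ', sub_le_sub_iff_left, div_le_div_iff_of_pos_right hNpos]

lemma Design.Dpow_neg_one (θ : Param m) (hθ : θ ∈ paramSpace m) :
    (Matrix.diagonal (S.cellProb θ))⁻¹ = S.Dpow θ (0 - 1) := by
  refine Matrix.inv_eq_right_inv ?_
  rw [Design.Dpow, Matrix.diagonal_mul_diagonal, ← Matrix.diagonal_one]
  congr 1
  funext j
  rw [zero_sub, Real.rpow_neg_one, mul_inv_cancel₀ (S.cellProb_pos hθ j).ne']

lemma Design.fisherInfo_eq_J {θ : Param m} (hθ : θ ∈ paramSpace m) :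
    S.fisherInfo θ = S.J 0 θ := by
  have hlog : ∀ j a, partialDeriv (fun θ' => Real.log (S.cellProb θ' j)) θ a
      = (S.cellProb θ j)⁻¹ * S.W θ j a := by
    intro j a
    have h1 : DifferentiableAt ℝ (fun θ : Param m => S.cellProb θ j) θ :=
      differentiableAt_pi.1 (S.differentiableAt_cellProb hθ) j
    rw [partialDeriv, fderiv.log h1 (S.cellProb_pos hθ j).ne']
    rfl
  ext a b
  simp only [Design.fisherInfo, Matrix.of_apply, hlog]
  rw [Design.J, Matrix.mul_apply]
  refine Finset.sum_congr rfl fun j _ => ?_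
  rw [Design.Dpow, Matrix.mul_diagonal, Matrix.transpose_apply, zero_sub, Real.rpow_neg_one]
  have := (S.cellProb_pos hθ j).ne'
  field_simp

lemma Design.sum_W {θ : Param m} (hθ : θ ∈ paramSpace m) (i : Fin (m + 2)) :
    ∑ j, S.W θ j i = 0 := by
  have h1 : ∀ j, DifferentiableAt ℝ (fun θ : Param m => S.cellProb θ j) θ :=
    differentiableAt_pi.1 (S.differentiableAt_cellProb hθ)
  have h2 : fderiv ℝ (fun θ : Param m => ∑ j, S.cellProb θ j) θ = 0 := by
    simp only [S.sum_cellProb]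
    exact fderiv_const_apply _
  rw [fderiv_fun_sum fun j _ => h1 j] at h2
  have h3 := congrArg (fun f => f (EuclideanSpace.single i (1 : ℝ))) h2
  simpa [Design.W, partialDeriv] using h3

/-- At β = 0 the vector π^β is constantly 1, and Wᵀ annihilates it because the cell probabilities
sum to 1. -/
lemma Design.K_zero {θ : Param m} (hθ : θ ∈ paramSpace m) : S.K 0 θ = S.J 0 θ := by
  have h : (S.W θ).transpose * Matrix.vecMulVec (fun j => S.cellProb θ j ^ (0 : ℝ))
      (fun j => S.cellProb θ j ^ (0 : ℝ)) = 0 := by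
    rw [Matrix.mul_vecMulVec]
    have : (S.W θ).transpose.mulVec (fun j => S.cellProb θ j ^ (0 : ℝ)) = 0 := by
      funext i
      simpa [Matrix.mulVec, dotProduct] using S.sum_W hθ i
    rw [this, Matrix.zero_vecMulVec]
  rw [Design.K, Design.J, Matrix.mul_sub, h, sub_zero, mul_zero]

lemma Design.asympCov_zero {θ : Param m} (hθ : θ ∈ paramSpace m) (hJ : IsUnit (S.J 0 θ).det) :
    S.asympCov 0 θ = (S.fisherInfo θ)⁻¹ := by
  rw [Design.asympCov, S.K_zero hθ, S.fisherInfo_eq_J hθ, Matrix.nonsing_inv_mul _ hJ,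
    Matrix.one_mul]

/-! ### Asymptotic normality -/

/-- The deterministic core, free of probability: it holds for every probability vector near the
model point, and for all minimizers at once. -/
lemma Design.eventually_mdpde_approx {β : ℝ} (hβ : 0 ≤ β) {θ₀ : Param m} (hθ₀ : θ₀ ∈ paramSpace m)
    (hid : S.IdentifiableAt θ₀) (hJ : IsUnit (S.J β θ₀).det) {ε : ℝ} (hε : 0 < ε) :
    ∀ᶠ p in 𝓝 (S.cellProb θ₀), ∑ j, p j = 1 →
      (∃ θ ∈ paramSpace m, IsMinOn (fun θ' => dpd β p (S.cellProb θ')) (paramSpace m) θ) ∧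
      ∀ θ ∈ paramSpace m, IsMinOn (fun θ' => dpd β p (S.cellProb θ')) (paramSpace m) θ →
        ‖θ - θ₀ - matrixCLM (S.influence β θ₀) (WithLp.toLp 2 (p - S.cellProb θ₀))‖
          ≤ ε * ‖(WithLp.toLp 2 (p - S.cellProb θ₀) : EuclideanSpace ℝ (Fin (L + 1)))‖ := by
  have hΘ := isOpen_paramSpace.mem_nhds hθ₀
  have hpos : ∀ θ ∈ paramSpace m, ∀ j, 0 < S.cellProb θ j := fun θ hθ => S.cellProb_pos hθ
  have hsum : ∀ θ ∈ paramSpace m, ∑ j, S.cellProb θ j = 1 := fun θ _ => S.sum_cellProb θ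
  have hprop : ∀ ε > 0, ∃ η > 0, ∀ θ ∈ paramSpace m,
      (∀ j, |S.cellProb θ j - S.cellProb θ₀ j| < η) → ‖θ - θ₀‖ < ε :=
    fun ε hε => hid.exists_forall_norm_sub_lt S hθ₀ hε
  have hcont : ContinuousOn (fun θ : Param m => S.cellProb θ) (paramSpace m) := fun θ hθ =>
    (S.differentiableAt_cellProb hθ).continuousAt.continuousWithinAt
  have hd : HasFDerivAt (fun θ : Param m => (WithLp.toLp 2 (S.cellProb θ) :
      EuclideanSpace ℝ (Fin (L + 1)))) (matrixCLM (S.W θ₀)) θ₀ := by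
    rw [← hasFDerivWithinAt_univ, hasFDerivWithinAt_euclidean]
    intro j
    rw [hasFDerivWithinAt_univ]
    have h1 : DifferentiableAt ℝ (fun θ : Param m => S.cellProb θ j) θ₀ :=
      differentiableAt_pi.1 (S.differentiableAt_cellProb hθ₀) j
    have h2 : (PiLp.proj 2 (fun _ : Fin (L + 1) => ℝ) j ∘L matrixCLM (S.W θ₀) : Param m →L[ℝ] ℝ)
        = fderiv ℝ (fun θ : Param m => S.cellProb θ j) θ₀ :=
      ContinuousLinearMap.ext fun v => S.W_mulVec θ₀ v j
    rw [h2]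
    exact h1.hasFDerivAt
  have hinj : Function.Injective (matrixCLM (S.W θ₀)) := by
    intro v w hvw
    have h1 := congrArg WithLp.ofLp hvw
    rw [matrixCLM_apply, matrixCLM_apply] at h1
    exact WithLp.ofLp_injective 2 ((S.isUnit_det_J_iff β hθ₀).1 hJ h1)
  -- These are the normal equations J_β A z = Wᵀ D^(β-1) z of weighted least squares.
  have horth : ∀ (z : EuclideanSpace ℝ (Fin (L + 1))) (h : Param m),
      ∑ j, S.cellProb θ₀ j ^ (β - 1) *
        (z j - matrixCLM (S.W θ₀) (matrixCLM (S.influence β θ₀) z) j)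
        * matrixCLM (S.W θ₀) h j = 0 := by
    intro z h
    have h1 : h.ofLp ⬝ᵥ (S.J β θ₀).mulVec ((S.influence β θ₀).mulVec z.ofLp)
        = h.ofLp ⬝ᵥ ((S.W θ₀).transpose * S.Dpow θ₀ (β - 1)).mulVec z.ofLp := by
      rw [Matrix.mulVec_mulVec, Design.influence, Matrix.mul_assoc,
        Matrix.mul_nonsing_inv_cancel_left _ _ hJ]
    have h2 : h.ofLp ⬝ᵥ ((S.W θ₀).transpose * S.Dpow θ₀ (β - 1)).mulVec z.ofLp
        = ∑ j, S.cellProb θ₀ j ^ (β - 1) * ((S.W θ₀).mulVec h.ofLp j * z j) := by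
      rw [← Matrix.mulVec_mulVec, Matrix.dotProduct_mulVec, Matrix.vecMul_transpose, dotProduct]
      refine Finset.sum_congr rfl fun j _ => ?_
      rw [Design.Dpow, Matrix.mulVec_diagonal]
      ring
    rw [S.dotProduct_J_mulVec, h2] at h1
    simp only [matrixCLM_apply]
    rw [← sub_eq_zero, ← Finset.sum_sub_distrib] at h1
    rw [← neg_eq_zero, ← Finset.sum_neg_distrib, ← h1]
    exact Finset.sum_congr rfl fun j _ => by ring
  filter_upwards [eventually_exists_isMinOn_dpd hβ hΘ hpos hsum hprop hcont,
    eventually_norm_argmin_sub_le hβ hΘ hpos hsum hprop hd hinj _ horth hε] with p h1 h2 hp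
  exact ⟨h1 hp, h2 hp⟩

/-- Asymptotic normality of minimum density power divergence estimators at an identified parameter
with nonsingular `J_β`. -/
theorem Design.tendstoInDistribution_mdpde {β : ℝ} (hβ : 0 ≤ β) {θ₀ : Param m}
    (hθ₀ : θ₀ ∈ paramSpace m) (hid : S.IdentifiableAt θ₀) (hJ : IsUnit (S.J β θ₀).det)
    {Ω : ℕ → Type*} [∀ N, MeasurableSpace (Ω N)] {P : (N : ℕ) → Measure (Ω N)}
    [∀ N, IsProbabilityMeasure (P N)] {n : (N : ℕ) → Ω N → Fin (L + 1) → ℕ}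
    (hn : ∀ N, IsMultinomial (P N) N (S.cellProb θ₀) (n N))
    {θhat : (N : ℕ) → Ω N → Param m} (hmeas : ∀ N, AEMeasurable (θhat N) (P N))
    (hmin : ∀ N, ∀ᵐ ω ∂(P N), (∃ θ : Param m, S.IsMDPDE β (n N ω) θ) →
      S.IsMDPDE β (n N ω) (θhat N ω)) :
    TendstoInDistribution (fun (N : ℕ) ω => √(N : ℝ) • (θhat N ω - θ₀)) atTop id P
      (multivariateGaussian 0 (S.asympCov β θ₀)) := by
  have hp : ∀ j, 0 ≤ S.cellProb θ₀ j := fun j => (S.cellProb_pos hθ₀ j).le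
  have hs := S.sum_cellProb θ₀
  refine IsMultinomial.tendstoInDistribution_of_linear_approx hn hp hs
    (matrixCLM (S.influence β θ₀)) hmeas ?_ (S.posSemidef_asympCov β hθ₀) ?_
  · intro ε hε
    have hc : Continuous fun z : EuclideanSpace ℝ (Fin (L + 1)) => z.ofLp + S.cellProb θ₀ := by
      fun_prop
    have hlim : Tendsto (fun z : EuclideanSpace ℝ (Fin (L + 1)) => z.ofLp + S.cellProb θ₀) (𝓝 0)
        (𝓝 (S.cellProb θ₀)) := by
      simpa using hc.tendsto 0
    obtain ⟨δ, hδ, h⟩ := Metric.eventually_nhds_iff.1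
      (hlim.eventually (S.eventually_mdpde_approx hβ hθ₀ hid hJ hε))
    refine ⟨δ, hδ, ?_⟩
    -- For N = 0 the empirical vector is 0 and does not sum to 1.
    filter_upwards [eventually_gt_atTop 0] with N hN
    filter_upwards [(hn N).ae_sum_eq hp hs, hmin N] with ω hω hωmin hlt
    have hemp : (empiricalError (S.cellProb θ₀) (n N ω)).ofLp + S.cellProb θ₀
        = empirical (n N ω) := by
      funext j
      simp [empiricalError]
    have hsum : ∑ j, empirical (n N ω) j = 1 := by
      have h1 : ∑ i, (n N ω i : ℝ) = N := by exact_mod_cast hω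
      have h2 : (N : ℝ) ≠ 0 := by exact_mod_cast hN.ne'
      simp only [empirical, ← Finset.sum_div]
      rw [h1, div_self h2]
    have h1 := h (y := empiricalError (S.cellProb θ₀) (n N ω)) (by rwa [dist_zero_right])
    rw [hemp] at h1
    obtain ⟨⟨θ, hθ, hθmin⟩, h2⟩ := h1 hsum
    obtain ⟨h3, h4⟩ := hωmin ⟨θ, hθ, hθmin⟩
    exact h2 _ h3 h4
  · intro t
    rw [S.asympCov_eq β hθ₀, ← Matrix.mulVec_mulVec, ← Matrix.mulVec_mulVec,
      Matrix.dotProduct_mulVec, ← Matrix.mulVec_transpose, dotProduct_multinomialCov,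
      adjoint_matrixCLM_apply]

/-- The regularity conditions imply identifiability and nonsingularity of `J_β`. -/
lemma Design.identifiableAt_and_isUnit (hm : m = 1 ∨ m = 2) {β : ℝ} {θ₀ : Param m}
    (hθ₀ : θ₀ ∈ paramSpace m)
    (hreg : m + 1 ≤ (S.k : ℕ) ∨ m + 1 ≤ L - (S.k : ℕ) ∨
      (S.IdentifiableAt θ₀ ∧ IsUnit (S.J β θ₀).det)) :
    S.IdentifiableAt θ₀ ∧ IsUnit (S.J β θ₀).det := by
  rcases hreg with hk | hk | h
  · exact ⟨S.identifiableAt_of_first_phase hm hk hθ₀,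
      (S.isUnit_det_J_iff β hθ₀).2 (S.injective_W_mulVec hm (Or.inl hk) hθ₀)⟩
  · exact ⟨S.identifiableAt_of_second_phase hk hθ₀,
      (S.isUnit_det_J_iff β hθ₀).2 (S.injective_W_mulVec hm (Or.inr hk) hθ₀)⟩
  · exact h

end StepStress

end

theorem theorem3
    -- linear (`m = 1`) or quadratic (`m = 2`) baseline hazard
    (m : ℕ) (hm : m = 1 ∨ m = 2) (L : ℕ) (S : StepStress.Design L)
    -- tuning parameter and true parameter
    (β : ℝ) (hβ : 0 ≤ β) (θ₀ : StepStress.Param m) (hθ₀ : θ₀ ∈ StepStress.paramSpace m)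
    -- one of the two stress phases contains at least `m + 1` inspection times; failing that,
    -- `θ₀` is assumed to be identified and `J_β(θ₀)` to be invertible
    (hreg : m + 1 ≤ (S.k : ℕ) ∨ m + 1 ≤ L - (S.k : ℕ) ∨
      (S.IdentifiableAt θ₀ ∧ IsUnit (S.J β θ₀).det))
    -- for every `N`, multinomial failure counts of `N` devices and an MDPDE based on them
    (Ω : ℕ → Type*) [∀ N, MeasurableSpace (Ω N)] (P : (N : ℕ) → Measure (Ω N))
    [∀ N, IsProbabilityMeasure (P N)]
    (n : (N : ℕ) → Ω N → Fin (L + 1) → ℕ)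
    (hn : ∀ N, StepStress.IsMultinomial (P N) N (S.cellProb θ₀) (n N))
    (θhat : (N : ℕ) → Ω N → StepStress.Param m) (hmeas : ∀ N, AEMeasurable (θhat N) (P N))
    (hmin : ∀ N, ∀ᵐ ω ∂(P N), (∃ θ : StepStress.Param m, S.IsMDPDE β (n N ω) θ) →
      S.IsMDPDE β (n N ω) (θhat N ω)) :
    (DifferentiableAt ℝ (fun θ : StepStress.Param m => S.cellProb θ) θ₀ ∧
      IsUnit (S.J β θ₀).det ∧ (S.asympCov β θ₀).PosSemidef ∧
      TendstoInDistribution (fun (N : ℕ) ω => √(N : ℝ) • (θhat N ω - θ₀)) atTop id P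
        (multivariateGaussian 0 (S.asympCov β θ₀))) ∧
    -- the case `β = 0`: maximum likelihood and the Fisher information
    (∀ (v : Fin (L + 1) → ℕ) (θ : StepStress.Param m), S.IsMDPDE 0 v θ ↔ S.IsMLE v θ) ∧
    S.fisherInfo θ₀ =
      (S.W θ₀).transpose * (Matrix.diagonal (S.cellProb θ₀))⁻¹ * S.W θ₀ ∧
    S.asympCov 0 θ₀ = (S.fisherInfo θ₀)⁻¹ := by
  obtain ⟨hid, hJ⟩ := S.identifiableAt_and_isUnit hm hθ₀ hreg
  have hJ0 : IsUnit (S.J 0 θ₀).det :=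
    (S.isUnit_det_J_iff 0 hθ₀).2 ((S.isUnit_det_J_iff β hθ₀).1 hJ)
  refine ⟨⟨S.differentiableAt_cellProb hθ₀, hJ, S.posSemidef_asympCov β hθ₀,
    S.tendstoInDistribution_mdpde hβ hθ₀ hid hJ hn hmeas hmin⟩, S.isMDPDE_zero_iff, ?_,
    S.asympCov_zero hθ₀ hJ0⟩
  rw [S.fisherInfo_eq_J hθ₀, S.Dpow_neg_one θ₀ hθ₀, StepStress.Design.J]
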